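/- Let $T$ be a complete first-order theory in a language $L$, and let $\mathbb{M}\models T$ be a monster model: for some uncountable strong limit cardinal $\kappa>|L|$, $\mathbb{M}$ is $\kappa$-saturated and strongly $\kappa$-homogeneous; "small" means of cardinality $<\kappa$, and "model" means small elementary substructure $M\prec\mathbb{M}$. Definitions. $T$ is $\mathrm{NSOP}_3$ if there is no formula $R(x_1,x_2)$ ($x_1,x_2$ finite tuples of variables of equal length) which in some model of $T$ has no $3$-cycles $R(c_0,c_1)\wedge R(c_1,c_2)\wedge R(c_2,c_0)$, but for which there are tuples $(a_i)_{i<\omega}$ in that model with $R(a_i,a_j)$ for all $i<j$. A global type is a complete type $p(x)$ over $\mathbb{M}$, where $x$ is a (possibly infinite) small tuple of variables. It is $M$-invariant if $\varphi(x,b)\in p$ and $b\equiv_M b'$ imply $\varphi(x,b')\in p$, and $M$-finitely satisfiable if every formula in $p$ is satisfied by a tuple from $M$. An invariant Morley sequence over $M$ in an $M$-invariant type $p$ is a sequence $(b_i)_{i<\omega}$ with $b_i\models p|_{M\cup\{b_j:j<i\}}$ for all $i$; its type over $M$ depends only on $p$ and is denoted $p^{\omega}|_M$. A formula $\varphi(x,b)$,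 with $b$ a finite tuple, Kim-divides (respectively, Conant-divides) over $M$ if $\{\varphi(x,b_i)\}_{i<\omega}$ is inconsistent for some (respectively, for every) invariant Morley sequence $(b_i)_{i<\omega}$ over $M$ with $b_0=b$. It Kim-forks (respectively, Conant-forks) over $M$ if it implies a finite disjunction of formulas, with parameters in $\mathbb{M}$, each of which Kim-divides (respectively, Conant-divides) over $M$. One says that $A$ is Kim-independent (respectively, Conant-independent) from $B$ over $M$ if $\mathrm{tp}(A/MB)$ contains no formula that Kim-forks (respectively, Conant-forks) over $M$. Conant-independence is symmetric if, for all models $M$ and all small $A,B$, if $A$ is Conant-independent from $B$ over $M$ then $B$ is Conant-independent from $A$ over $M$. Theorem. Suppose that $T$ is $\mathrm{NSOP}_3$ and that Conant-independence is symmetric. Let $M$ be a model, let $p(x)$ and $q(x)$ be $M$-finitely satisfiable global types with $p^{\omega}|_M=q^{\omega}|_M$, and let $a,b\supseteq M$ be small sets such that $a$ is Kim-independent from $b$ over $M$. Then there is $c\models p|_a\cup q|_b$ such that $c$ is Conant-independent from $a\cup b$ over $M$. -/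

import Mathlib

universe u v w

open FirstOrder FirstOrder.Language Cardinal

namespace ModelIndep

section

variable {L : FirstOrder.Language.{u, v}}

/-- `T` is `NSOP_n`: there is no formula `R(x₁, x₂)`, in two finite tuples of variables of the same
length, such that in some model of `T` the relation it defines has no `n`-cycles but satisfies
`R(aᵢ, aⱼ)` for all `i < j`, for some infinite sequence of tuples `a₀, a₁, …`.
The models range over the universe `w`. -/
def NSOP (T : L.Theory) (n : ℕ) : Prop :=
  ∀ (N : Type w) [L.Structure N] [Nonempty N] [N ⊨ T] (k : ℕ) (R : L.Formula (Fin k ⊕ Fin k)),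
    (∃ a : ℕ → Fin k → N, ∀ i j, i < j → R.Realize (Sum.elim (a i) (a j))) →
    ∃ c : Fin n → Fin k → N, ∀ i, R.Realize (Sum.elim (c i) (c (finRotate n i)))

end

section

variable (L : FirstOrder.Language.{u, v}) (𝕄 : Type w) [L.Structure 𝕄]

/-- `𝕄` is a monster model, with `κ` as the bound for smallness: `κ` is an uncountable strong limit
cardinal greater than the number of symbols of the language, and `𝕄` is `κ`-saturated and strongly
`κ`-homogeneous. -/
structure IsMonster (κ : Cardinal.{w}) : Prop where
  aleph0_lt : ℵ₀ < κ
  isStrongLimit : κ.IsStrongLimit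
  card_lt : Cardinal.lift.{w} L.card < Cardinal.lift.{max u v} κ
  /-- Every finitely satisfiable set of formulas in fewer than `κ` variables over fewer than `κ`
  parameters is realized. -/
  saturated : ∀ (A : Set 𝕄) (α : Type w) (Γ : Set (L[[A]].Formula α)), #A < κ → #α < κ →
    (∀ s : Finset (L[[A]].Formula α), ↑s ⊆ Γ → ∃ x : α → 𝕄, ∀ φ ∈ s, φ.Realize x) →
    ∃ x : α → 𝕄, ∀ φ ∈ Γ, φ.Realize x
  /-- Any two tuples of length less than `κ` of the same type are conjugate by an automorphism. -/
  homogeneous : ∀ (α : Type w) (x y : α → 𝕄), #α < κ →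
    (∀ φ : L.Formula α, φ.Realize x ↔ φ.Realize y) →
    ∃ g : 𝕄 ≃[L] 𝕄, ∀ i, g (x i) = y i

/-- Global types `p(x)`, `x = (xᵢ)_{i ∈ α}`: complete types over `𝕄`. -/
abbrev GlobalType (α : Type w) : Type _ := (L.elementaryDiagram 𝕄).CompleteType α

end

variable {L : FirstOrder.Language.{u, v}} {𝕄 : Type w} [L.Structure 𝕄]

/-- The formula `φ(x, b)` with parameters in `𝕄` obtained from `φ(x, y)` and a tuple `b`. -/
def inst {α β : Type*} (φ : L.Formula (α ⊕ β)) (b : β → 𝕄) : L[[𝕄]].Formula α :=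
  BoundedFormula.subst ((L.lhomWithConstants 𝕄).onFormula φ)
    (Sum.elim Term.var fun i => (L.con (b i)).term)

theorem realize_inst {α β : Type*} (φ : L.Formula (α ⊕ β)) (b : β → 𝕄) (x : α → 𝕄) :
    (inst φ b).Realize x ↔ φ.Realize (Sum.elim x b) := by
  unfold inst Formula.Realize
  rw [BoundedFormula.realize_subst, LHom.onFormula, LHom.realize_onBoundedFormula]
  have : (fun a => Term.realize x (Sum.elim Term.var (fun i => (L.con (b i)).term) a)) =
      Sum.elim x b := by
    funext a
    cases a with
    | inl i => rfl
    | inr i => exact Term.realize_constants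
  rw [this]

/-- `φ(x, b) ∈ p`. -/
def GlobalType.Has {α : Type w} (p : GlobalType L 𝕄 α) {n : ℕ} (φ : L.Formula (α ⊕ Fin n))
    (b : Fin n → 𝕄) : Prop :=
  Formula.equivSentence (inst φ b) ∈ p

/-- `b ≡_A b'`. -/
def EqTypeOver (L : FirstOrder.Language.{u, v}) {𝕄 : Type w} [L.Structure 𝕄] (A : Set 𝕄) {β : Type*}
    (b b' : β → 𝕄) : Prop :=
  ∀ φ : L[[A]].Formula β, φ.Realize b ↔ φ.Realize b'

/-- `p` is invariant over `M`. -/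
def GlobalType.IsInvariant {α : Type w} (p : GlobalType L 𝕄 α)
    (M : L.ElementarySubstructure 𝕄) : Prop :=
  ∀ (n : ℕ) (φ : L.Formula (α ⊕ Fin n)) (b b' : Fin n → 𝕄),
    EqTypeOver L (M : Set 𝕄) b b' → p.Has φ b → p.Has φ b'

/-- `p` is finitely satisfiable over `M`. -/
def GlobalType.IsFinSat {α : Type w} (p : GlobalType L 𝕄 α)
    (M : L.ElementarySubstructure 𝕄) : Prop :=
  ∀ (n : ℕ) (φ : L.Formula (α ⊕ Fin n)) (b : Fin n → 𝕄), p.Has φ b →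
    ∃ m : α → 𝕄, (∀ i, m i ∈ M) ∧ φ.Realize (Sum.elim m b)

/-- `c ⊨ p|_A`. -/
def GlobalType.RealizedOver {α : Type w} (p : GlobalType L 𝕄 α) (A : Set 𝕄) (c : α → 𝕄) : Prop :=
  ∀ (n : ℕ) (φ : L.Formula (α ⊕ Fin n)) (b : Fin n → 𝕄), (∀ i, b i ∈ A) → p.Has φ b →
    φ.Realize (Sum.elim c b)

/-- `(bᵢ)_{i < ω}` is a Morley sequence over `M` in `p`: `bᵢ ⊨ p|_{M ∪ {bⱼ : j < i}}`. -/
def GlobalType.IsMorley {α : Type w} (p : GlobalType L 𝕄 α) (M : L.ElementarySubstructure 𝕄)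
    (b : ℕ → α → 𝕄) : Prop :=
  ∀ i, p.RealizedOver ((M : Set 𝕄) ∪ ⋃ j < i, Set.range (b j)) (b i)

/-- `p^ω|_M`, for `p` invariant over `M`: the type over `M`, in the variables `(xᵢ)_{i < ω}`, of the
Morley sequences over `M` in `p` (all of these have the same type over `M`). -/
def GlobalType.morleyPower {α : Type w} (p : GlobalType L 𝕄 α) (M : L.ElementarySubstructure 𝕄) :
    Set (L[[(M : Set 𝕄)]].Formula (ℕ × α)) :=
  {φ | ∀ b : ℕ → α → 𝕄, p.IsMorley M b → φ.Realize fun k => b k.1 k.2}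

/-- `(bᵢ)_{i < ω}` is an invariant Morley sequence over `M`. The tuples are indexed by
`ULift (Fin n)` in the type variables only to place them in the universe `w`. -/
def IsInvMorley (M : L.ElementarySubstructure 𝕄) {n : ℕ} (b : ℕ → Fin n → 𝕄) : Prop :=
  ∃ p : GlobalType L 𝕄 (ULift.{w} (Fin n)),
    p.IsInvariant M ∧ p.IsMorley M fun i k => b i k.down

/-- `φ(x, b)` Kim-divides over `M`. -/
def KimDivides (M : L.ElementarySubstructure 𝕄) {α : Type w} {n : ℕ} (φ : L.Formula (α ⊕ Fin n))
    (b : Fin n → 𝕄) : Prop :=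
  ∃ s : ℕ → Fin n → 𝕄, IsInvMorley M s ∧ s 0 = b ∧
    ¬ ∃ x : α → 𝕄, ∀ i, φ.Realize (Sum.elim x (s i))

/-- `φ(x, b)` Conant-divides over `M`. -/
def ConantDivides (M : L.ElementarySubstructure 𝕄) {α : Type w} {n : ℕ}
    (φ : L.Formula (α ⊕ Fin n)) (b : Fin n → 𝕄) : Prop :=
  ∀ s : ℕ → Fin n → 𝕄, IsInvMorley M s → s 0 = b →
    ¬ ∃ x : α → 𝕄, ∀ i, φ.Realize (Sum.elim x (s i))

/-- `φ(x, b)` Kim-forks over `M`: it implies a finite disjunction of formulas `ψⱼ(x, eⱼ)`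
that Kim-divide over `M`. -/
def KimForks (M : L.ElementarySubstructure 𝕄) {α : Type w} {n : ℕ} (φ : L.Formula (α ⊕ Fin n))
    (b : Fin n → 𝕄) : Prop :=
  ∃ (m : ℕ) (k : Fin m → ℕ) (ψ : ∀ j, L.Formula (α ⊕ Fin (k j))) (e : ∀ j, Fin (k j) → 𝕄),
    (∀ j, KimDivides M (ψ j) (e j)) ∧
    ∀ x : α → 𝕄, φ.Realize (Sum.elim x b) → ∃ j, (ψ j).Realize (Sum.elim x (e j))

/-- `φ(x, b)` Conant-forks over `M`: it implies a finite disjunction of formulas `ψⱼ(x, eⱼ)`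
that Conant-divide over `M`. -/
def ConantForks (M : L.ElementarySubstructure 𝕄) {α : Type w} {n : ℕ}
    (φ : L.Formula (α ⊕ Fin n)) (b : Fin n → 𝕄) : Prop :=
  ∃ (m : ℕ) (k : Fin m → ℕ) (ψ : ∀ j, L.Formula (α ⊕ Fin (k j))) (e : ∀ j, Fin (k j) → 𝕄),
    (∀ j, ConantDivides M (ψ j) (e j)) ∧
    ∀ x : α → 𝕄, φ.Realize (Sum.elim x b) → ∃ j, (ψ j).Realize (Sum.elim x (e j))

/-- `A` is Kim-independent from `B` over `M`: no formula in `tp(A/MB)` Kim-forks over `M`,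
where `A` is regarded as a tuple indexed by itself. -/
def KimIndep (M : L.ElementarySubstructure 𝕄) (A B : Set 𝕄) : Prop :=
  ∀ (n : ℕ) (φ : L.Formula (A ⊕ Fin n)) (d : Fin n → 𝕄), (∀ i, d i ∈ (M : Set 𝕄) ∪ B) →
    φ.Realize (Sum.elim Subtype.val d) → ¬ KimForks M φ d

/-- `A` is Conant-independent from `B` over `M`: no formula in `tp(A/MB)` Conant-forks over `M`,
where `A` is regarded as a tuple indexed by itself. -/
def ConantIndep (M : L.ElementarySubstructure 𝕄) (A B : Set 𝕄) : Prop :=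
  ∀ (n : ℕ) (φ : L.Formula (A ⊕ Fin n)) (d : Fin n → 𝕄), (∀ i, d i ∈ (M : Set 𝕄) ∪ B) →
    φ.Realize (Sum.elim Subtype.val d) → ¬ ConantForks M φ d

/-- Conant-independence is symmetric: for all small models `M` and small sets `A`, `B`,
if `A` is Conant-independent from `B` over `M`, then `B` is Conant-independent from `A` over `M`. -/
def ConantSymmetric (L : FirstOrder.Language.{u, v}) (𝕄 : Type w) [L.Structure 𝕄] (κ : Cardinal.{w}) : Prop :=
  ∀ (M : L.ElementarySubstructure 𝕄) (A B : Set 𝕄), #M < κ → #A < κ → #B < κ →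
    ConantIndep M A B → ConantIndep M B A

end ModelIndep

/-! An `M`-finitely satisfiable type is the average of an ultrafilter on tuples from `M`; let `U`
and `V` be ultrafilters for `p` and `q`. The heart of the matter is to find one sequence `C` that is
Morley in `U` over `a` and Morley in `V` over `b` (`KimIndep.exists_joint_morley`). Let `c` realize
over `a ∪ b` the limit type of `C` along a nonprincipal ultrafilter. Then `c` realizes `p|_a` and
`q|_b`, and `a ∪ b` is Conant-independent from `c` (`Morley.conantIndep`); symmetry finishes.

If no such `C` exists, compactness gives contradictory formulas `Φ(z, a)` and `Ψ(z, b)`, each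
holding of all the Morley sequences concerned and invariant under conjugation over `M`
(`IsMonster.exists_morley_or`). By `NSOP₃` there cannot be `aᵢ, bᵢ, cᵢ` with `Φ(cₖ, aᵢ)` for `i <
k`, `Ψ(cₖ, bⱼ)` for `k < j`, and `Φ(z, aⱼ) ∧ Ψ(z, bᵢ)` inconsistent for `i < j`
(`NSOP.exists_realize`). Such an array is constructed twice, with `(aⱼ, bᵢ)` conjugate to `(a, b)`
for `i < j`.

When `tp(a/b)` is finitely satisfiable in `M`, a single growing sequence is built whose tails are
Morley in `U` over the earlier `aᵢ`. Because `p^ω|_M = q^ω|_M`, its initial segments can also be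
made Morley in `V` over each new `bⱼ`; blocks of the sequence serve as the `cₖ`. This is
`IsMonster.exists_joint_morley_of_av`.

In general, Kim-independence gives `aₙ` related to each of `b₀, …, bₙ` as `a` is to `b`, where
`(bᵢ)` is a Morley sequence and each `bₙ` is also generic over the earlier `aᵢ`. For each `k`, the
tail `(bⱼ)_{j > k}` is then finitely satisfiable over `a₀, …, aₖ`, so the first case supplies `cₖ`.
-/

namespace ModelIndep

/-- A sequence can be built step by step, each term satisfying a condition that depends on the
earlier terms. -/
theorem exists_seq {X : Type*} [Nonempty X] (P : ℕ → (ℕ → X) → X → Prop)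
    (hloc : ∀ n f f' x, (∀ i < n, f i = f' i) → P n f x → P n f' x)
    (hstep : ∀ n f, (∀ i < n, P i f (f i)) → ∃ x, P n f x) :
    ∃ f, ∀ n, P n f (f n) := by
  classical
  let F : (n : ℕ) → ((m : ℕ) → m < n → X) → X := fun n h =>
    Classical.epsilon (P n fun i => if hi : i < n then h i hi else Classical.arbitrary X)
  let f : ℕ → X := fun n => Nat.strongRecOn n F
  have hf : ∀ n, f n = Classical.epsilon
      (P n fun i => if i < n then f i else Classical.arbitrary X) := by
    intro n
    have : f n = F n fun m _ => f m := Nat.strongRecOn_eq F n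
    rw [this]
    simp [F]
  refine ⟨f, fun n => ?_⟩
  induction n using Nat.strong_induction_on with
  | _ n ih =>
    set f' : ℕ → X := fun i => if i < n then f i else Classical.arbitrary X
    have hag : ∀ i < n, f' i = f i := fun i hi => if_pos hi
    have h : ∃ x, P n f' x := by
      refine hstep n f' fun i hi => ?_
      rw [hag i hi]
      exact hloc i f f' _ (fun j hj => (hag j (hj.trans hi)).symm) (ih i hi)
    rw [hf n]
    exact hloc n f' f _ hag (Classical.epsilon_spec h)

variable {L : FirstOrder.Language.{u, v}}

/-! ### Formulas depend on finitely many variables -/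

section FiniteSupport

theorem exists_finite_support {X : Type*} (φ : L.Formula X) :
    ∃ (n : ℕ) (e : Fin n → X) (ψ : L.Formula (Fin n)), Function.Injective e ∧
      ∀ (N : Type w) [L.Structure N] (x : X → N), φ.Realize x ↔ ψ.Realize (x ∘ e) := by
  classical
  let s := BoundedFormula.freeVarFinset φ
  let e := s.equivFin
  refine ⟨s.card, fun i => (e.symm i : X), BoundedFormula.restrictFreeVar φ e,
    fun i j hij => e.symm.injective (Subtype.ext hij), fun N _ x => ?_⟩
  unfold Formula.Realize
  exact (BoundedFormula.realize_restrictFreeVar (f := e) x (fun a => by simp)).symm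

theorem exists_finite_support_sum {X Y : Type*} (φ : L.Formula (X ⊕ Y)) :
    ∃ (m n : ℕ) (d : Fin m → X) (e : Fin n → Y) (ψ : L.Formula (Fin m ⊕ Fin n)),
      Function.Injective d ∧ Function.Injective e ∧
      ∀ (N : Type w) [L.Structure N] (x : X → N) (y : Y → N),
        φ.Realize (Sum.elim x y) ↔ ψ.Realize (Sum.elim (x ∘ d) (y ∘ e)) := by
  classical
  obtain ⟨n, e, ψ, -, h⟩ := exists_finite_support.{u, v, w} φ
  let s : Finset X := (Finset.univ.image e).toLeft
  let t : Finset Y := (Finset.univ.image e).toRight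
  have hs : ∀ i x, e i = Sum.inl x → x ∈ s := fun i x hx => by
    simp only [s, Finset.mem_toLeft, Finset.mem_image, Finset.mem_univ, true_and]
    exact ⟨i, hx⟩
  have ht : ∀ i x, e i = Sum.inr x → x ∈ t := fun i x hx => by
    simp only [t, Finset.mem_toRight, Finset.mem_image, Finset.mem_univ, true_and]
    exact ⟨i, hx⟩
  let g : Fin n → Fin s.card ⊕ Fin t.card := fun i =>
    match hi : e i with
    | Sum.inl x => Sum.inl (s.equivFin ⟨x, hs i x hi⟩)
    | Sum.inr y => Sum.inr (t.equivFin ⟨y, ht i y hi⟩)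
  refine ⟨s.card, t.card, fun i => (s.equivFin.symm i : X), fun i => (t.equivFin.symm i : Y),
    ψ.relabel g, fun i j hij => s.equivFin.symm.injective (Subtype.ext hij),
    fun i j hij => t.equivFin.symm.injective (Subtype.ext hij), fun N _ x y => ?_⟩
  rw [h, Formula.realize_relabel]
  have : Sum.elim x y ∘ e = Sum.elim (x ∘ fun i => (s.equivFin.symm i : X))
      (y ∘ fun i => (t.equivFin.symm i : Y)) ∘ g := by
    funext i
    simp only [Function.comp_apply, g]
    split
    · next z hz => simp [hz]
    · next z hz => simp [hz]
  rw [this]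

theorem exists_finite_support_right {X Y : Type*} (φ : L.Formula (X ⊕ Y)) :
    ∃ (n : ℕ) (e : Fin n → Y) (ψ : L.Formula (X ⊕ Fin n)),
      ∀ (N : Type w) [L.Structure N] (x : X → N) (y : Y → N),
        φ.Realize (Sum.elim x y) ↔ ψ.Realize (Sum.elim x (y ∘ e)) := by
  obtain ⟨m, n, d, e, ψ, -, -, h⟩ := exists_finite_support_sum.{u, v, w} φ
  refine ⟨n, e, ψ.relabel (Sum.map d id), fun N _ x y => ?_⟩
  rw [h, Formula.realize_relabel, Sum.elim_comp_map]
  rfl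

/-- Only finitely many coordinates of `X` occur in the formula, so quantifying over a possibly
infinite tuple is still first-order; nonemptiness fills the other coordinates. -/
theorem exists_exists_formula {X Y : Type*} (φ : L.Formula (X ⊕ Y)) :
    ∃ ψ : L.Formula Y, ∀ (N : Type w) [L.Structure N] [Nonempty N] (y : Y → N),
      ψ.Realize y ↔ ∃ x : X → N, φ.Realize (Sum.elim x y) := by
  obtain ⟨m, n, d, e, ψ, hd, -, h⟩ := exists_finite_support_sum.{u, v, w} φ
  refine ⟨Formula.iExs (Fin m) ((ψ.relabel (Sum.map id e)).relabel Sum.swap),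
    fun N _ _ y => ?_⟩
  rw [Formula.realize_iExs]
  simp only [Formula.realize_relabel]
  constructor
  · rintro ⟨x, hx⟩
    refine ⟨Function.extend d x fun _ => Classical.arbitrary N, ?_⟩
    rw [h]
    convert hx using 1
    funext i
    rcases i with i | i
    · simp [hd.extend_apply]
    · simp
  · rintro ⟨x, hx⟩
    rw [h] at hx
    refine ⟨x ∘ d, ?_⟩
    convert hx using 1
    funext i
    rcases i with i | i <;> simp

theorem exists_support {X : Type*} (φ : L.Formula X) :
    ∃ s : Finset X, ∀ (N : Type w) [L.Structure N] (x y : X → N), (∀ i ∈ s, x i = y i) →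
      (φ.Realize x ↔ φ.Realize y) := by
  classical
  obtain ⟨n, e, ψ, -, h⟩ := exists_finite_support.{u, v, w} φ
  refine ⟨Finset.univ.image e, fun N _ x y hxy => ?_⟩
  rw [h, h]
  have : x ∘ e = y ∘ e := funext fun i => hxy _ (by simp)
  rw [this]

end FiniteSupport

variable {𝕄 : Type w} [L.Structure 𝕄]

/-! ### Types, automorphisms and saturation -/

section SameType

variable (L) in
/-- The tuples `x` and `y` have the same type over the empty set. -/
def SameType {X : Type*} (x y : X → 𝕄) : Prop :=
  ∀ φ : L.Formula X, φ.Realize x ↔ φ.Realize y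

variable (L) in
/-- The tuples `x` and `y` have the same type over `A`. -/
def SameTypeOver (A : Set 𝕄) {X : Type*} (x y : X → 𝕄) : Prop :=
  SameType L (Sum.elim x ((↑) : A → 𝕄)) (Sum.elim y ((↑) : A → 𝕄))

theorem realize_comp_equiv (g : 𝕄 ≃[L] 𝕄) {X : Type*} (φ : L.Formula X) (x : X → 𝕄) :
    φ.Realize (g ∘ x) ↔ φ.Realize x :=
  StrongHomClass.realize_formula g φ

theorem sameType_of_imp {X : Type*} {x y : X → 𝕄}
    (h : ∀ φ : L.Formula X, φ.Realize x → φ.Realize y) : SameType L x y := fun φ =>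
  ⟨h φ, fun hy => by_contra fun hx => (h φ.not hx) hy⟩

variable (L) in
/-- The automorphism `g` fixes `A` pointwise. -/
def Fixes (g : 𝕄 ≃[L] 𝕄) (A : Set 𝕄) : Prop := ∀ m ∈ A, g m = m

theorem Fixes.mono {g : 𝕄 ≃[L] 𝕄} {A B : Set 𝕄} (h : Fixes L g B) (hAB : A ⊆ B) : Fixes L g A :=
  fun m hm => h m (hAB hm)

theorem Fixes.symm {g : 𝕄 ≃[L] 𝕄} {A : Set 𝕄} (h : Fixes L g A) : Fixes L g.symm A :=
  fun m hm => by
    conv_lhs => rw [← h m hm]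
    exact g.symm_apply_apply m

theorem Fixes.comp {g h : 𝕄 ≃[L] 𝕄} {A : Set 𝕄} (hg : Fixes L g A) (hh : Fixes L h A) :
    Fixes L (g.comp h) A := fun m hm => by
  rw [Equiv.comp_apply, hh m hm, hg m hm]

theorem Fixes.sameTypeOver {g : 𝕄 ≃[L] 𝕄} {A : Set 𝕄} (h : Fixes L g A) {X : Type*} (x : X → 𝕄) :
    SameTypeOver L A (g ∘ x) x := fun φ => by
  rw [← realize_comp_equiv g φ (Sum.elim x _), Sum.comp_elim]
  have : g ∘ ((↑) : A → 𝕄) = (↑) := funext fun m => h m m.2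
  rw [this]

variable {κ : Cardinal.{w}}

theorem IsMonster.exists_equiv (h𝕄 : IsMonster L 𝕄 κ) {X : Type w} (hX : #X < κ) {x y : X → 𝕄}
    (h : SameType L x y) : ∃ g : 𝕄 ≃[L] 𝕄, g ∘ x = y := by
  obtain ⟨g, hg⟩ := h𝕄.homogeneous X x y hX h
  exact ⟨g, funext hg⟩

theorem IsMonster.sum_lt (h𝕄 : IsMonster L 𝕄 κ) {X Y : Type w} (hX : #X < κ) (hY : #Y < κ) :
    #(X ⊕ Y) < κ := by
  rw [mk_sum, lift_id, lift_id]
  exact add_lt_of_lt h𝕄.aleph0_lt.le hX hY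

theorem IsMonster.nat_prod_lt (h𝕄 : IsMonster L 𝕄 κ) {X : Type w} (hX : #X < κ) :
    #(ℕ × X) < κ := by
  rw [mk_prod, lift_id', mk_nat, lift_aleph0]
  exact mul_lt_of_lt h𝕄.aleph0_lt.le h𝕄.aleph0_lt hX

theorem IsMonster.union_lt (h𝕄 : IsMonster L 𝕄 κ) {A B : Set 𝕄} (hA : #A < κ) (hB : #B < κ) :
    #(A ∪ B : Set 𝕄) < κ :=
  (mk_union_le A B).trans_lt (add_lt_of_lt h𝕄.aleph0_lt.le hA hB)

theorem mk_range_lt {X : Type w} (hX : #X < κ) (x : X → 𝕄) : #(Set.range x) < κ :=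
  mk_range_le.trans_lt hX

theorem IsMonster.iUnion_range_lt (h𝕄 : IsMonster L 𝕄 κ) {X : Type w} (hX : #X < κ)
    (x : ℕ → X → 𝕄) (P : ℕ → Prop) : #(⋃ (i) (_ : P i), Set.range (x i) : Set 𝕄) < κ := by
  refine (mk_le_mk_of_subset ?_).trans_lt
    (mk_range_lt (h𝕄.nat_prod_lt hX) fun k : ℕ × X => x k.1 k.2)
  intro m hm
  simp only [Set.mem_iUnion, Set.mem_range] at hm
  obtain ⟨i, -, k, rfl⟩ := hm
  exact ⟨(i, k), rfl⟩

theorem IsMonster.exists_fixes (h𝕄 : IsMonster L 𝕄 κ) {X : Type w} (hX : #X < κ) {A : Set 𝕄}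
    (hA : #A < κ) {x y : X → 𝕄} (h : SameTypeOver L A x y) :
    ∃ g : 𝕄 ≃[L] 𝕄, Fixes L g A ∧ g ∘ x = y := by
  obtain ⟨g, hg⟩ := h𝕄.exists_equiv (h𝕄.sum_lt hX hA) h
  refine ⟨g, fun m hm => ?_, ?_⟩
  · exact congrFun hg (Sum.inr ⟨m, hm⟩)
  · funext i
    exact congrFun hg (Sum.inl i)

theorem exists_constants_formula {A : Set 𝕄} {X Y : Type*} (y : Y → 𝕄) (hy : ∀ i, y i ∈ A)
    (φ : L.Formula (X ⊕ Y)) :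
    ∃ ψ : L[[A]].Formula X, ∀ x : X → 𝕄, ψ.Realize x ↔ φ.Realize (Sum.elim x y) := by
  let r : X ⊕ Y → A ⊕ X := Sum.elim Sum.inr fun i => Sum.inl ⟨y i, hy i⟩
  let ψ : L[[A]].Formula X := BoundedFormula.constantsVarsEquiv.symm (φ.relabel r)
  refine ⟨ψ, fun x => ?_⟩
  have h1 := BoundedFormula.realize_constantsVarsEquiv (L := L) (M := 𝕄) (φ := ψ) (v := x)
    (xs := default)
  rw [Formula.Realize, ← h1]
  simp only [ψ, _root_.Equiv.apply_symm_apply]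
  change (φ.relabel r).Realize _ ↔ _
  rw [Formula.realize_relabel]
  have : (Sum.elim (fun a => ↑(L.con a)) x) ∘ r = Sum.elim x y := by
    funext i
    rcases i with i | i <;> rfl
  exact iff_of_eq (congrArg _ this)

/-- Finitely satisfiable sets of formulas with parameters from a small family are realized. -/
theorem IsMonster.exists_realize (h𝕄 : IsMonster L 𝕄 κ) {X Y : Type w} (hX : #X < κ) (hY : #Y < κ)
    (y : Y → 𝕄) (Γ : Set (L.Formula (X ⊕ Y)))
    (hΓ : ∀ s : Finset (L.Formula (X ⊕ Y)), ↑s ⊆ Γ → ∃ x : X → 𝕄, ∀ φ ∈ s,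
      φ.Realize (Sum.elim x y)) :
    ∃ x : X → 𝕄, ∀ φ ∈ Γ, φ.Realize (Sum.elim x y) := by
  classical
  choose t ht using exists_constants_formula (L := L) (X := X) y fun i => Set.mem_range_self i
  have hfin : ∀ s : Finset (L[[Set.range y]].Formula X), ↑s ⊆ t '' Γ →
      ∃ x : X → 𝕄, ∀ φ ∈ s, φ.Realize x := by
    intro s hs
    obtain ⟨s', hs', rfl⟩ := Finset.subset_set_image_iff.1 hs
    obtain ⟨x, hx⟩ := hΓ s' hs'
    refine ⟨x, fun φ hφ => ?_⟩
    obtain ⟨ψ, hψ, rfl⟩ := Finset.mem_image.1 hφ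
    exact (ht ψ x).2 (hx ψ hψ)
  obtain ⟨x, hx⟩ := h𝕄.saturated (Set.range y) X (t '' Γ) (mk_range_lt hY y) hX hfin
  exact ⟨x, fun φ hφ => (ht φ x).1 (hx _ ⟨φ, hφ, rfl⟩)⟩

end SameType

end ModelIndep

namespace ModelIndep

variable {L : FirstOrder.Language.{u, v}} {𝕄 : Type w} [L.Structure 𝕄] {κ : Cardinal.{w}}

/-! ### Average types of ultrafilters -/

section Average

variable (L) in
/-- The tuple `c` realizes over `A` the average type of the ultrafilter `U`. -/
def Av {X : Type w} (U : Ultrafilter (X → 𝕄)) (A : Set 𝕄) (c : X → 𝕄) : Prop :=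
  ∀ φ : L.Formula (X ⊕ A), (∀ᶠ m in (U : Filter (X → 𝕄)), φ.Realize (Sum.elim m (↑))) →
    φ.Realize (Sum.elim c (↑))

/-- The ultrafilter `U` concentrates on tuples from `S`. -/
def OnSet {X : Type w} (U : Ultrafilter (X → 𝕄)) (S : Set 𝕄) : Prop :=
  ∀ᶠ m in (U : Filter (X → 𝕄)), ∀ i, m i ∈ S

variable {X : Type w} {U : Ultrafilter (X → 𝕄)} {A B S : Set 𝕄} {c c' : X → 𝕄}

theorem Av.realize_iff (h : Av L U A c) {Y : Type*} (b : Y → 𝕄) (hb : ∀ i, b i ∈ A)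
    (φ : L.Formula (X ⊕ Y)) :
    φ.Realize (Sum.elim c b) ↔ ∀ᶠ m in (U : Filter (X → 𝕄)), φ.Realize (Sum.elim m b) := by
  have key : ∀ φ : L.Formula (X ⊕ Y),
      (∀ᶠ m in (U : Filter (X → 𝕄)), φ.Realize (Sum.elim m b)) → φ.Realize (Sum.elim c b) := by
    intro φ hφ
    have hrel : ∀ x, (φ.relabel (Sum.map id fun i => (⟨b i, hb i⟩ : A))).Realize
        (Sum.elim x ((↑) : A → 𝕄)) ↔ φ.Realize (Sum.elim x b) := fun x => by
      rw [Formula.realize_relabel, Sum.elim_comp_map]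
      rfl
    rw [← hrel]
    exact h _ (hφ.mono fun m hm => (hrel m).2 hm)
  refine ⟨fun hc => ?_, key φ⟩
  by_contra hU
  rw [← Ultrafilter.eventually_not] at hU
  exact key φ.not hU hc

theorem Av.mono (h : Av L U B c) (hAB : A ⊆ B) : Av L U A c := fun φ hφ =>
  (h.realize_iff ((↑) : A → 𝕄) (fun i => hAB i.2) φ).2 hφ

theorem Av.sameTypeOver (h : Av L U A c) (h' : Av L U A c') : SameTypeOver L A c c' := fun φ => by
  rw [h.realize_iff _ (fun i => i.2), h'.realize_iff _ (fun i => i.2)]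

/-- An automorphism fixing `S` pointwise fixes every tuple from `S`, hence the average type of an
ultrafilter concentrated there. This is the source of all invariance below. -/
theorem Av.comp_equiv (h : Av L U A c) (hU : OnSet U S) {g : 𝕄 ≃[L] 𝕄} (hg : Fixes L g S) :
    Av L U (g '' A) (g ∘ c) := by
  intro φ hφ
  have hb : ∀ i : g '' A, g.symm (i : 𝕄) ∈ A := by
    rintro ⟨-, m, hm, rfl⟩
    simpa using hm
  have hgb : g ∘ (fun i : g '' A => g.symm (i : 𝕄)) = ((↑) : g '' A → 𝕄) :=
    funext fun i => g.apply_symm_apply _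
  rw [← hgb, ← Sum.comp_elim, realize_comp_equiv, h.realize_iff _ hb]
  filter_upwards [hφ, hU] with m hm hmS
  rw [← realize_comp_equiv g, Sum.comp_elim, hgb]
  have : g ∘ m = m := funext fun i => hg _ (hmS i)
  rwa [this]

theorem Av.comp_map (h : Av L U A c) {Y : Type w} (e : Y → X) :
    Av L (U.map fun m => m ∘ e) A (c ∘ e) := by
  intro φ hφ
  have hrel : ∀ x : X → 𝕄, (φ.relabel (Sum.map e id)).Realize (Sum.elim x ((↑) : A → 𝕄)) ↔
      φ.Realize (Sum.elim (x ∘ e) (↑)) := fun x => by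
    rw [Formula.realize_relabel, Sum.elim_comp_map]
    rfl
  rw [← hrel]
  exact h _ (Filter.Eventually.mono hφ fun m hm => (hrel m).2 hm)

theorem OnSet.comp_map (h : OnSet U S) {Y : Type w} (e : Y → X) :
    OnSet (U.map fun m => m ∘ e) S :=
  Filter.mem_of_superset (x := {m : X → 𝕄 | ∀ i, m i ∈ S}) h fun _ hm i => hm (e i)

theorem IsMonster.exists_av (h𝕄 : IsMonster L 𝕄 κ) (hX : #X < κ) (U : Ultrafilter (X → 𝕄))
    (hA : #A < κ) : ∃ c, Av L U A c := by
  refine h𝕄.exists_realize hX hA ((↑) : A → 𝕄)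
    {φ | ∀ᶠ m in (U : Filter (X → 𝕄)), φ.Realize (Sum.elim m (↑))} fun s hs => ?_
  have : ∀ᶠ m in (U : Filter (X → 𝕄)), ∀ φ ∈ s, φ.Realize (Sum.elim m ((↑) : A → 𝕄)) :=
    (Filter.eventually_all_finset s).2 fun φ hφ => hs hφ
  exact this.exists

end Average

/-! ### Morley sequences in average types -/

section Morley

variable (L) in
/-- `c` is a Morley sequence over `A` in the average type of `U`. -/
def Morley {X : Type w} (U : Ultrafilter (X → 𝕄)) (A : Set 𝕄) (c : ℕ → X → 𝕄) : Prop :=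
  ∀ i, Av L U (A ∪ ⋃ j < i, Set.range (c j)) (c i)

variable {X : Type w} {U : Ultrafilter (X → 𝕄)} {A B S : Set 𝕄} {c c' : ℕ → X → 𝕄}

theorem Morley.mono (h : Morley L U B c) (hAB : A ⊆ B) : Morley L U A c := fun i =>
  (h i).mono (Set.union_subset_union_left _ hAB)

theorem Morley.av (h : Morley L U A c) (i : ℕ) : Av L U A (c i) :=
  (h i).mono Set.subset_union_left

theorem Morley.comp_strictMono (h : Morley L U A c) {f : ℕ → ℕ} (hf : StrictMono f) :
    Morley L U A fun i => c (f i) := fun i =>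
  (h (f i)).mono <| Set.union_subset_union_right _ <| Set.iUnion₂_subset fun j hj =>
    Set.subset_iUnion₂_of_subset (f j) (hf hj) subset_rfl

theorem Morley.comp_map (h : Morley L U A c) {Y : Type w} (e : Y → X) :
    Morley L (U.map fun m => m ∘ e) A fun i => c i ∘ e := fun i =>
  ((h i).comp_map e).mono <| Set.union_subset_union_right _ <| Set.iUnion₂_mono fun _ _ =>
    Set.range_comp_subset_range _ _

theorem Morley.comp_equiv (h : Morley L U A c) (hU : OnSet U S) {g : 𝕄 ≃[L] 𝕄}
    (hg : Fixes L g S) : Morley L U (g '' A) fun i => g ∘ c i := fun i => by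
  refine ((h i).comp_equiv hU hg).mono ?_
  simp only [Set.image_union, Set.image_iUnion, Set.range_comp]
  exact subset_rfl

theorem IsMonster.exists_morley_extending (h𝕄 : IsMonster L 𝕄 κ) (hX : #X < κ)
    (U : Ultrafilter (X → 𝕄)) (hA : #A < κ) (n : ℕ) (c : ℕ → X → 𝕄)
    (hc : ∀ i < n, Av L U (A ∪ ⋃ j < i, Set.range (c j)) (c i)) :
    ∃ c', Morley L U A c' ∧ ∀ i < n, c' i = c i := by
  have : Nonempty (X → 𝕄) := ⟨c 0⟩
  have hloc : ∀ (i : ℕ) (f f' : ℕ → X → 𝕄), (∀ j < i, f j = f' j) →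
      (⋃ j < i, Set.range (f j)) = ⋃ j < i, Set.range (f' j) := fun i f f' h =>
    Set.iUnion₂_congr fun j hj => by rw [h j hj]
  have hstep : ∀ (i : ℕ) (f : ℕ → X → 𝕄),
      (∀ j < i, Av L U (A ∪ ⋃ k < j, Set.range (f k)) (f j) ∧ (j < n → f j = c j)) →
      ∃ x, Av L U (A ∪ ⋃ j < i, Set.range (f j)) x ∧ (i < n → x = c i) := by
    intro i f hf
    by_cases hi : i < n
    · refine ⟨c i, ?_, fun _ => rfl⟩
      rw [hloc i f c fun j hj => (hf j hj).2 (hj.trans hi)]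
      exact hc i hi
    · obtain ⟨x, hx⟩ := h𝕄.exists_av hX U
        (h𝕄.union_lt hA (h𝕄.iUnion_range_lt hX f fun j => j < i))
      exact ⟨x, hx, fun h => absurd h hi⟩
  obtain ⟨f, hf⟩ := exists_seq
    (fun i (f : ℕ → X → 𝕄) x => Av L U (A ∪ ⋃ j < i, Set.range (f j)) x ∧ (i < n → x = c i))
    (fun i f f' x h => by rw [hloc i f f' h]; exact id) hstep
  exact ⟨f, fun i => (hf i).1, fun i => (hf i).2⟩

theorem IsMonster.exists_morley (h𝕄 : IsMonster L 𝕄 κ) [Nonempty 𝕄] (hX : #X < κ)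
    (U : Ultrafilter (X → 𝕄)) (hA : #A < κ) : ∃ c, Morley L U A c := by
  obtain ⟨c, hc, -⟩ := h𝕄.exists_morley_extending hX U hA 0 (fun _ _ => Classical.arbitrary 𝕄)
    (by simp)
  exact ⟨c, hc⟩

/-- The type of a sequence is determined by the types of its initial segments. -/
theorem sameTypeOver_of_initial
    (h : ∀ n, ∃ d : ℕ → X → 𝕄, SameTypeOver L A (fun k : ℕ × X => d k.1 k.2)
      (fun k => c' k.1 k.2) ∧ ∀ i < n, d i = c i) :
    SameTypeOver L A (fun k : ℕ × X => c k.1 k.2) (fun k => c' k.1 k.2) := by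
  intro φ
  obtain ⟨s, hs⟩ := exists_support.{u, v, w} φ
  obtain ⟨n, hn⟩ : ∃ n, ∀ k x, Sum.inl (k, x) ∈ s → k < n := by
    classical
    refine ⟨(s.toLeft.image Prod.fst).sup id + 1, fun k x hk => Nat.lt_succ_of_le ?_⟩
    exact Finset.le_sup (f := id) (Finset.mem_image.2 ⟨(k, x), Finset.mem_toLeft.2 hk, rfl⟩)
  obtain ⟨d, hd, hdn⟩ := h n
  rw [← hd φ]
  refine hs 𝕄 _ _ fun i hi => ?_
  rcases i with ⟨k, x⟩ | i
  · exact (congrFun (hdn k (hn k x hi)) x).symm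
  · rfl

/-- Uniqueness of Morley sequences. Initial segments are matched one term at a time by invariance of
the average type; since formulas see only initial segments, homogeneity then gives one automorphism
for the whole sequence. -/
theorem IsMonster.exists_fixes_morley (h𝕄 : IsMonster L 𝕄 κ) (hX : #X < κ) (hA : #A < κ)
    (hU : OnSet U S) (hS : S ⊆ A) (hc : Morley L U A c) (hc' : Morley L U A c') :
    ∃ g : 𝕄 ≃[L] 𝕄, Fixes L g A ∧ ∀ i, g ∘ c i = c' i := by
  have key : ∀ n, ∃ g : 𝕄 ≃[L] 𝕄, Fixes L g A ∧ ∀ i < n, g ∘ c i = c' i := by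
    intro n
    induction n with
    | zero => exact ⟨Language.Equiv.refl L 𝕄, fun m _ => rfl, by simp⟩
    | succ n ih =>
      obtain ⟨g, hg, hgc⟩ := ih
      have h1 : Av L U (A ∪ ⋃ j < n, Set.range (c' j)) (g ∘ c n) := by
        refine ((hc n).comp_equiv hU (hg.mono hS)).mono ?_
        rw [Set.image_union, Set.image_iUnion₂]
        refine Set.union_subset_union (fun m hm => ⟨m, hm, hg m hm⟩) ?_
        refine Set.iUnion₂_mono fun j hj => ?_
        rw [← hgc j hj, Set.range_comp]
      obtain ⟨h, hh, hhc⟩ := h𝕄.exists_fixes hX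
        (h𝕄.union_lt hA (h𝕄.iUnion_range_lt hX c' fun j => j < n)) (h1.sameTypeOver (hc' n))
      refine ⟨h.comp g, (hh.mono Set.subset_union_left).comp hg, fun i hi => ?_⟩
      rcases Nat.lt_succ_iff_lt_or_eq.1 hi with hi | rfl
      · rw [← hgc i hi]
        funext x
        refine hh _ (Or.inr (Set.mem_iUnion₂.2 ⟨i, hi, ?_⟩))
        rw [← hgc i hi]
        exact ⟨x, rfl⟩
      · exact hhc
  have hsame : SameTypeOver L A (fun k : ℕ × X => c k.1 k.2) (fun k => c' k.1 k.2) := by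
    refine fun φ => (sameTypeOver_of_initial (c := c') (c' := c) fun n => ?_) φ |>.symm
    obtain ⟨g, hg, hgc⟩ := key n
    exact ⟨fun i => g ∘ c i, hg.sameTypeOver fun k : ℕ × X => c k.1 k.2, hgc⟩
  obtain ⟨g, hg, hgc⟩ := h𝕄.exists_fixes (h𝕄.nat_prod_lt hX) hA hsame
  exact ⟨g, hg, fun i => funext fun x => congrFun hgc (i, x)⟩

theorem Morley.of_sameTypeOver (h𝕄 : IsMonster L 𝕄 κ) (hX : #X < κ) (hA : #A < κ)
    (hU : OnSet U S) (hS : S ⊆ A) (hc : Morley L U A c)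
    (h : SameTypeOver L A (fun k : ℕ × X => c k.1 k.2) fun k => c' k.1 k.2) :
    Morley L U A c' := by
  obtain ⟨g, hg, hgc⟩ := h𝕄.exists_fixes (h𝕄.nat_prod_lt hX) hA h
  have : c' = fun i => g ∘ c i := funext fun i => funext fun x => (congrFun hgc (i, x)).symm
  rw [this]
  refine (hc.comp_equiv hU (hg.mono hS)).mono fun m hm => ⟨m, hm, hg m hm⟩

end Morley

theorem realize_elim_comp_equiv (g : 𝕄 ≃[L] 𝕄) {X Y : Type*} (φ : L.Formula (X ⊕ Y)) (x : X → 𝕄)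
    (y : Y → 𝕄) : φ.Realize (Sum.elim (g ∘ x) (g ∘ y)) ↔ φ.Realize (Sum.elim x y) := by
  rw [← Sum.comp_elim, realize_comp_equiv]

/-! ### Consequences of `NSOP₃` -/

section NSOP

variable {T : L.Theory} [Nonempty 𝕄] [𝕄 ⊨ T]

/-- In the definition of `NSOP`, one may allow formulas in possibly infinite tuples. -/
theorem NSOP.exists_cycle {n : ℕ} (hT : NSOP.{u, v, w} T n) {V : Type*} (R : L.Formula (V ⊕ V))
    (a : ℕ → V → 𝕄) (ha : ∀ i j, i < j → R.Realize (Sum.elim (a i) (a j))) :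
    ∃ c : Fin n → V → 𝕄, ∀ i, R.Realize (Sum.elim (c i) (c (finRotate n i))) := by
  classical
  obtain ⟨m, k, d, e, ψ, -, -, h⟩ := exists_finite_support_sum.{u, v, w} R
  let s : Finset V := Finset.univ.image d ∪ Finset.univ.image e
  have hd : ∀ i, d i ∈ s := fun i => by simp [s]
  have he : ∀ i, e i ∈ s := fun i => by simp [s]
  let f : Fin s.card → V := fun i => s.equivFin.symm i
  have hf : Function.Injective f := fun i j hij => s.equivFin.symm.injective (Subtype.ext hij)
  let R' : L.Formula (Fin s.card ⊕ Fin s.card) :=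
    ψ.relabel (Sum.map (fun i => s.equivFin ⟨d i, hd i⟩) fun i => s.equivFin ⟨e i, he i⟩)
  have hR' : ∀ x y : V → 𝕄,
      R'.Realize (Sum.elim (x ∘ f) (y ∘ f)) ↔ R.Realize (Sum.elim x y) := fun x y => by
    rw [h, Formula.realize_relabel, Sum.elim_comp_map]
    have h1 : (x ∘ f) ∘ (fun i => s.equivFin ⟨d i, hd i⟩) = x ∘ d := funext fun i => by simp [f]
    have h2 : (y ∘ f) ∘ (fun i => s.equivFin ⟨e i, he i⟩) = y ∘ e := funext fun i => by simp [f]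
    rw [h1, h2]
  obtain ⟨c, hc⟩ := hT 𝕄 s.card R' ⟨fun i => a i ∘ f, fun i j hij => (hR' _ _).2 (ha i j hij)⟩
  have hext : ∀ i, Function.extend f (c i) (fun _ => Classical.arbitrary 𝕄) ∘ f = c i :=
    fun i => funext fun j => hf.extend_apply _ _ _
  refine ⟨fun i => Function.extend f (c i) fun _ => Classical.arbitrary 𝕄, fun i => ?_⟩
  rw [← hR', hext, hext]
  exact hc i

/-- In an `NSOP₃` theory, there is no array `(aᵢ, bᵢ, cᵢ)` such that `cₖ` satisfies `Φ(x, aᵢ)` for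
`i < k` and `Ψ(x, bⱼ)` for `k < j`, while `Φ(x, aⱼ) ∧ Ψ(x, bᵢ)` is inconsistent for `i < j`. -/
theorem NSOP.exists_realize (hT : NSOP.{u, v, w} T 3) {X Y Z : Type*} (Φ : L.Formula (X ⊕ Y))
    (Ψ : L.Formula (X ⊕ Z)) (c : ℕ → X → 𝕄) (a : ℕ → Y → 𝕄) (b : ℕ → Z → 𝕄)
    (hΦ : ∀ i k, i < k → Φ.Realize (Sum.elim (c k) (a i)))
    (hΨ : ∀ k j, k < j → Ψ.Realize (Sum.elim (c k) (b j))) :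
    ∃ i j, i < j ∧ ∃ x, Φ.Realize (Sum.elim x (a j)) ∧ Ψ.Realize (Sum.elim x (b i)) := by
  by_contra! hcon
  obtain ⟨E, hE⟩ := exists_exists_formula.{u, v, w} (X := X) (Y := Y ⊕ Z)
    (Φ.relabel (Sum.map id Sum.inl) ⊓ Ψ.relabel (Sum.map id Sum.inr))
  have hE' : ∀ (y : Y → 𝕄) (z : Z → 𝕄), E.Realize (Sum.elim y z) ↔
      ∃ x, Φ.Realize (Sum.elim x y) ∧ Ψ.Realize (Sum.elim x z) := fun y z => by
    rw [hE]
    simp only [Formula.realize_inf, Formula.realize_relabel, Sum.elim_comp_map,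
      Sum.elim_comp_inl, Sum.elim_comp_inr, Function.comp_id]
  -- `R(z, z')`, for `z = (c, a, b)` and `z' = (c', a', b')`, says `Φ(c', a)`, `Ψ(c, b')`, and that
  -- `Φ(x, a') ∧ Ψ(x, b)` is inconsistent.
  let R : L.Formula ((X ⊕ (Y ⊕ Z)) ⊕ (X ⊕ (Y ⊕ Z))) :=
    Φ.relabel (Sum.elim (Sum.inr ∘ Sum.inl) (Sum.inl ∘ Sum.inr ∘ Sum.inl)) ⊓
      (Ψ.relabel (Sum.elim (Sum.inl ∘ Sum.inl) (Sum.inr ∘ Sum.inr ∘ Sum.inr)) ⊓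
        (E.relabel (Sum.elim (Sum.inr ∘ Sum.inr ∘ Sum.inl) (Sum.inl ∘ Sum.inr ∘ Sum.inr))).not)
  have hR : ∀ z z' : X ⊕ (Y ⊕ Z) → 𝕄, R.Realize (Sum.elim z z') ↔
      Φ.Realize (Sum.elim (z' ∘ Sum.inl) (z ∘ Sum.inr ∘ Sum.inl)) ∧
      Ψ.Realize (Sum.elim (z ∘ Sum.inl) (z' ∘ Sum.inr ∘ Sum.inr)) ∧
      ¬ ∃ x, Φ.Realize (Sum.elim x (z' ∘ Sum.inr ∘ Sum.inl)) ∧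
        Ψ.Realize (Sum.elim x (z ∘ Sum.inr ∘ Sum.inr)) := fun z z' => by
    simp only [R, Formula.realize_inf, Formula.realize_not, Formula.realize_relabel,
      Sum.comp_elim, ← Function.comp_assoc, Sum.elim_comp_inl, Sum.elim_comp_inr, hE']
  obtain ⟨z, hz⟩ := hT.exists_cycle R (fun i => Sum.elim (c i) (Sum.elim (a i) (b i)))
    (fun i j hij => by
      rw [hR]
      refine ⟨hΦ i j hij, hΨ i j hij, ?_⟩
      rintro ⟨x, hx1, hx2⟩
      exact hcon i j hij x hx1 hx2)
  have h0 := (hR _ _).1 (hz 0)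
  have h1 := (hR _ _).1 (hz 1)
  have h2 := (hR _ _).1 (hz 2)
  -- The middle term of the cycle satisfies `Φ` with the `a`-part of `z 0` and `Ψ` with the `b`-part
  -- of `z 2`, which the edge from `z 2` to `z 0` forbids.
  exact h2.2.2 ⟨z 1 ∘ Sum.inl, h0.1, h1.2.1⟩

end NSOP

/-! ### Compactness for pairs of types -/

section Compactness

theorem SameType.sameTypeOver_range {X Y : Type*} {x x' : X → 𝕄} {y : Y → 𝕄}
    (h : SameType L (Sum.elim x y) (Sum.elim x' y)) : SameTypeOver L (Set.range y) x x' := by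
  intro φ
  choose f hf using fun i : Set.range y => i.2
  have hrel : ∀ x : X → 𝕄, φ.Realize (Sum.elim x ((↑) : Set.range y → 𝕄)) ↔
      (φ.relabel (Sum.map id f)).Realize (Sum.elim x y) := fun x => by
    rw [Formula.realize_relabel, Sum.elim_comp_map]
    have : y ∘ f = (↑) := funext hf
    rw [this]
    rfl
  rw [hrel, hrel]
  exact h _

theorem realize_foldr_inf {X : Type*} (l : List (L.Formula X)) (x : X → 𝕄) :
    Formula.Realize (l.foldr (· ⊓ ·) (⊤ : L.Formula X)) x ↔ ∀ φ ∈ l, φ.Realize x :=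
  BoundedFormula.realize_foldr_inf l x default

/-- If the types of `x` over `a` and of `y` over `b` are contradictory, then so are some two
formulas in them. -/
theorem IsMonster.exists_sameType_or (h𝕄 : IsMonster L 𝕄 κ) {X Y Z : Type w} (hX : #X < κ)
    (hY : #Y < κ) (hZ : #Z < κ) (x y : X → 𝕄) (a : Y → 𝕄) (b : Z → 𝕄) :
    (∃ z : X → 𝕄, SameType L (Sum.elim x a) (Sum.elim z a) ∧
      SameType L (Sum.elim y b) (Sum.elim z b)) ∨
    ∃ (Φ : L.Formula (X ⊕ Y)) (Ψ : L.Formula (X ⊕ Z)), Φ.Realize (Sum.elim x a) ∧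
      Ψ.Realize (Sum.elim y b) ∧
      ¬ ∃ z, Φ.Realize (Sum.elim z a) ∧ Ψ.Realize (Sum.elim z b) := by
  classical
  rw [or_iff_not_imp_right]
  intro hcon
  push Not at hcon
  let t₁ : L.Formula (X ⊕ Y) → L.Formula (X ⊕ (Y ⊕ Z)) := fun φ => φ.relabel (Sum.map id Sum.inl)
  let t₂ : L.Formula (X ⊕ Z) → L.Formula (X ⊕ (Y ⊕ Z)) := fun φ => φ.relabel (Sum.map id Sum.inr)
  have ht₁ : ∀ φ z, (t₁ φ).Realize (Sum.elim z (Sum.elim a b)) ↔ φ.Realize (Sum.elim z a) :=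
    fun φ z => by
      simp only [t₁, Formula.realize_relabel, Sum.elim_comp_map, Sum.elim_comp_inl,
        Function.comp_id]
  have ht₂ : ∀ φ z, (t₂ φ).Realize (Sum.elim z (Sum.elim a b)) ↔ φ.Realize (Sum.elim z b) :=
    fun φ z => by
      simp only [t₂, Formula.realize_relabel, Sum.elim_comp_map, Sum.elim_comp_inr,
        Function.comp_id]
  obtain ⟨z, hz⟩ := h𝕄.exists_realize hX (h𝕄.sum_lt hY hZ) (Sum.elim a b)
    (t₁ '' {φ | φ.Realize (Sum.elim x a)} ∪ t₂ '' {φ | φ.Realize (Sum.elim y b)}) (by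
      intro s hs
      let s₁ := s.filter (· ∈ t₁ '' {φ | φ.Realize (Sum.elim x a)})
      let s₂ := s.filter (· ∈ t₂ '' {φ | φ.Realize (Sum.elim y b)})
      obtain ⟨r₁, hr₁, hs₁⟩ := Finset.subset_set_image_iff.1
        (show (s₁ : Set _) ⊆ t₁ '' _ from fun φ hφ => (Finset.mem_filter.1 hφ).2)
      obtain ⟨r₂, hr₂, hs₂⟩ := Finset.subset_set_image_iff.1
        (show (s₂ : Set _) ⊆ t₂ '' _ from fun φ hφ => (Finset.mem_filter.1 hφ).2)
      obtain ⟨z, hz₁, hz₂⟩ := hcon (r₁.toList.foldr (· ⊓ ·) ⊤) (r₂.toList.foldr (· ⊓ ·) ⊤)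
        ((realize_foldr_inf _ _).2 fun φ hφ => hr₁ (Finset.mem_toList.1 hφ))
        ((realize_foldr_inf _ _).2 fun φ hφ => hr₂ (Finset.mem_toList.1 hφ))
      rw [realize_foldr_inf] at hz₁ hz₂
      refine ⟨z, fun φ hφ => ?_⟩
      rcases hs hφ with h | h
      · have : φ ∈ Finset.image t₁ r₁ := hs₁ ▸ Finset.mem_filter.2 ⟨hφ, h⟩
        obtain ⟨ψ, hψ, rfl⟩ := Finset.mem_image.1 this
        exact (ht₁ ψ z).2 (hz₁ ψ (Finset.mem_toList.2 hψ))
      · have : φ ∈ Finset.image t₂ r₂ := hs₂ ▸ Finset.mem_filter.2 ⟨hφ, h⟩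
        obtain ⟨ψ, hψ, rfl⟩ := Finset.mem_image.1 this
        exact (ht₂ ψ z).2 (hz₂ ψ (Finset.mem_toList.2 hψ)))
  exact ⟨z, sameType_of_imp fun φ hφ => (ht₁ φ z).1 (hz _ (Or.inl ⟨φ, hφ, rfl⟩)),
    sameType_of_imp fun φ hφ => (ht₂ φ z).1 (hz _ (Or.inr ⟨φ, hφ, rfl⟩))⟩

theorem exists_bound {X Y : Type*} (φ : L.Formula ((ℕ × X) ⊕ Y)) :
    ∃ n, 0 < n ∧ ∀ (c c' : ℕ → X → 𝕄) (y : Y → 𝕄), (∀ i < n, c i = c' i) →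
      (φ.Realize (Sum.elim (fun k => c k.1 k.2) y) ↔
        φ.Realize (Sum.elim (fun k => c' k.1 k.2) y)) := by
  classical
  obtain ⟨s, hs⟩ := exists_support.{u, v, w} φ
  refine ⟨(s.toLeft.image Prod.fst).sup id + 1, Nat.succ_pos _, fun c c' y h =>
    hs 𝕄 _ _ fun i hi => ?_⟩
  rcases i with ⟨k, x⟩ | i
  · exact congrFun (h k (Nat.lt_succ_of_le (Finset.le_sup (f := id)
      (Finset.mem_image.2 ⟨(k, x), Finset.mem_toLeft.2 hi, rfl⟩)))) x
  · rfl

end Compactness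

/-! ### The obstruction to a common Morley sequence -/

section Joint

variable {X Y Z : Type w} {S : Set 𝕄}

variable (L) in
/-- Morley sequences over `S` in the average types of `U` and `V` have the same type over `S`. -/
def SamePower (U V : Ultrafilter (X → 𝕄)) (S : Set 𝕄) : Prop :=
  ∀ c c' : ℕ → X → 𝕄, Morley L U S c → Morley L V S c' →
    ∃ g : 𝕄 ≃[L] 𝕄, Fixes L g S ∧ ∀ i, g ∘ c i = c' i

theorem SamePower.symm {U V : Ultrafilter (X → 𝕄)} (h : SamePower L U V S) :
    SamePower L V U S := fun c c' hc hc' => by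
  obtain ⟨g, hg, hgc⟩ := h c' c hc' hc
  exact ⟨g.symm, hg.symm, fun i => funext fun x => by simp [← hgc i]⟩

/-- If the types of the two Morley sequences are jointly inconsistent, compactness isolates `Φ` and
`Ψ`. Uniqueness of Morley sequences makes them hold for every Morley sequence over every conjugate
of the parameters over `S`. -/
theorem IsMonster.exists_morley_or (h𝕄 : IsMonster L 𝕄 κ) [Nonempty 𝕄] (hX : #X < κ)
    (hY : #Y < κ) (hZ : #Z < κ) {U V : Ultrafilter (X → 𝕄)} (hU : OnSet U S) (hV : OnSet V S)
    (a : Y → 𝕄) (b : Z → 𝕄) (hSa : S ⊆ Set.range a) (hSb : S ⊆ Set.range b) :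
    (∃ c, Morley L U (Set.range a) c ∧ Morley L V (Set.range b) c) ∨
    ∃ (Φ : L.Formula ((ℕ × X) ⊕ Y)) (Ψ : L.Formula ((ℕ × X) ⊕ Z)),
      (∀ (g : 𝕄 ≃[L] 𝕄) (c : ℕ → X → 𝕄), Fixes L g S → Morley L U (Set.range (g ∘ a)) c →
        Φ.Realize (Sum.elim (fun k => c k.1 k.2) (g ∘ a))) ∧
      (∀ (g : 𝕄 ≃[L] 𝕄) (c : ℕ → X → 𝕄), Fixes L g S → Morley L V (Set.range (g ∘ b)) c →
        Ψ.Realize (Sum.elim (fun k => c k.1 k.2) (g ∘ b))) ∧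
      ∀ g : 𝕄 ≃[L] 𝕄,
        ¬ ∃ z, Φ.Realize (Sum.elim z (g ∘ a)) ∧ Ψ.Realize (Sum.elim z (g ∘ b)) := by
  obtain ⟨x, hx⟩ := h𝕄.exists_morley hX U (mk_range_lt hY a)
  obtain ⟨y, hy⟩ := h𝕄.exists_morley hX V (mk_range_lt hZ b)
  have key : ∀ {Y : Type w} (_ : #Y < κ) {U : Ultrafilter (X → 𝕄)} (_ : OnSet U S)
      (a : Y → 𝕄) (_ : S ⊆ Set.range a) (x : ℕ → X → 𝕄) (_ : Morley L U (Set.range a) x)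
      (Φ : L.Formula ((ℕ × X) ⊕ Y)) (_ : Φ.Realize (Sum.elim (fun k => x k.1 k.2) a))
      (g : 𝕄 ≃[L] 𝕄) (c : ℕ → X → 𝕄), Fixes L g S → Morley L U (Set.range (g ∘ a)) c →
        Φ.Realize (Sum.elim (fun k => c k.1 k.2) (g ∘ a)) := by
    intro Y hY U hU a hSa x hx Φ hΦ g c hg hc
    have hgx : Morley L U (Set.range (g ∘ a)) fun i => g ∘ x i := by
      rw [Set.range_comp]
      exact hx.comp_equiv hU hg
    obtain ⟨h, hh, hhc⟩ := h𝕄.exists_fixes_morley hX (mk_range_lt hY _) hU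
      (fun m hm => by
        obtain ⟨i, rfl⟩ := hSa hm
        exact ⟨i, hg _ hm⟩) hgx hc
    have h1 : h ∘ (g ∘ a) = g ∘ a := funext fun i => hh _ ⟨i, rfl⟩
    have h2 : (fun k : ℕ × X => c k.1 k.2) = h ∘ (g ∘ fun k => x k.1 k.2) :=
      funext fun k => (congrFun (hhc k.1) k.2).symm
    rw [h2, ← h1, realize_elim_comp_equiv, realize_elim_comp_equiv]
    exact hΦ
  rcases h𝕄.exists_sameType_or (h𝕄.nat_prod_lt hX) hY hZ (fun k => x k.1 k.2)
    (fun k => y k.1 k.2) a b with ⟨z, hza, hzb⟩ | ⟨Φ, Ψ, hΦ, hΨ, hcon⟩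
  · left
    exact ⟨fun i j => z (i, j),
      hx.of_sameTypeOver h𝕄 hX (mk_range_lt hY a) hU hSa hza.sameTypeOver_range,
      hy.of_sameTypeOver h𝕄 hX (mk_range_lt hZ b) hV hSb hzb.sameTypeOver_range⟩
  · right
    refine ⟨Φ, Ψ, key hY hU a hSa x hx Φ hΦ, key hZ hV b hSb y hy Ψ hΨ, ?_⟩
    rintro g ⟨z, hz⟩
    refine hcon ⟨g.symm ∘ z, ?_⟩
    have : z = g ∘ (g.symm ∘ z) := funext fun i => (g.apply_symm_apply _).symm
    rw [this, realize_elim_comp_equiv, realize_elim_comp_equiv] at hz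
    exact hz

end Joint

theorem Fixes.subset_range_comp {S : Set 𝕄} {g : 𝕄 ≃[L] 𝕄} (hg : Fixes L g S) {Y : Type*}
    {a : Y → 𝕄} (h : S ⊆ Set.range a) : S ⊆ Set.range (g ∘ a) := fun m hm => by
  obtain ⟨i, rfl⟩ := h hm
  exact ⟨i, hg _ hm⟩

/-! ### Common Morley sequences: the finitely satisfiable case -/

section

variable {T : L.Theory} [Nonempty 𝕄] [𝕄 ⊨ T] {X Y Z : Type w} {S : Set 𝕄}

/-- If the type of `a` over `b` is the average type of an ultrafilter on `S`, then a single
sequence is Morley over `a` in `U` and over `b` in `V`. -/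
theorem IsMonster.exists_joint_morley_of_av (h𝕄 : IsMonster L 𝕄 κ) (hT : NSOP.{u, v, w} T 3)
    (hX : #X < κ) (hY : #Y < κ) (hZ : #Z < κ) {U V : Ultrafilter (X → 𝕄)} (hU : OnSet U S)
    (hV : OnSet V S) (hUV : SamePower L U V S) (a : Y → 𝕄) (b : Z → 𝕄)
    (hSa : S ⊆ Set.range a) (hSb : S ⊆ Set.range b) {W : Ultrafilter (Y → 𝕄)} (hW : OnSet W S)
    (haW : Av L W (Set.range b) a) :
    ∃ c, Morley L U (Set.range a) c ∧ Morley L V (Set.range b) c := by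
  rcases h𝕄.exists_morley_or hX hY hZ hU hV a b hSa hSb with h | ⟨Φ, Ψ, hΦ, hΨ, hcon⟩
  · exact h
  exfalso
  have hS : #S < κ := (mk_le_mk_of_subset hSa).trans_lt (mk_range_lt hY a)
  -- The triple is `(bₙ, aₙ, cₙ)`: `bₙ` is a conjugate of `b` over which `c₀, …, cₙ₋₁` begins a
  -- `V`-Morley sequence, `aₙ` realizes `W` over all `bᵢ` with `i ≤ n`, and `cₙ` realizes `U` over
  -- `S`, all `aᵢ` with `i ≤ n`, and the earlier `cᵢ`.
  let P : ℕ → (ℕ → (Z → 𝕄) × (Y → 𝕄) × (X → 𝕄)) → (Z → 𝕄) × (Y → 𝕄) × (X → 𝕄) → Prop :=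
    fun n f t =>
      (∃ (g : 𝕄 ≃[L] 𝕄) (d : ℕ → X → 𝕄), Fixes L g S ∧ Morley L V (Set.range b) d ∧
        t.1 = g ∘ b ∧ ∀ i < n, (f i).2.2 = g ∘ d i) ∧
      Av L W (Set.range t.1 ∪ ⋃ i < n, Set.range (f i).1) t.2.1 ∧
      Av L U ((S ∪ (Set.range t.2.1 ∪ ⋃ i < n, Set.range (f i).2.1)) ∪
        ⋃ i < n, Set.range (f i).2.2) t.2.2
  have hloc : ∀ n f f' t, (∀ i < n, f i = f' i) → P n f t → P n f' t := by
    intro n f f' t hff ⟨⟨g, d, hg, hd, hgb, hgd⟩, h2, h3⟩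
    refine ⟨⟨g, d, hg, hd, hgb, fun i hi => (hff i hi) ▸ hgd i hi⟩, h2.mono ?_, h3.mono ?_⟩
    · refine Set.union_subset_union_right _ (Set.iUnion₂_mono fun i hi => ?_)
      rw [hff i hi]
    · refine Set.union_subset_union (Set.union_subset_union_right _
        (Set.union_subset_union_right _ (Set.iUnion₂_mono fun i hi => ?_)))
        (Set.iUnion₂_mono fun i hi => ?_) <;> rw [hff i hi]
  have hstep : ∀ n f, (∀ i < n, P i f (f i)) → ∃ t, P n f t := by
    intro n f hf
    obtain ⟨c, hc, hcf⟩ := h𝕄.exists_morley_extending hX U hS n (fun i => (f i).2.2)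
      fun i hi => (hf i hi).2.2.mono (Set.union_subset_union_left _ Set.subset_union_left)
    obtain ⟨d, hd⟩ := h𝕄.exists_morley hX V (mk_range_lt hZ b)
    -- Equality of the Morley powers moves a `V`-Morley sequence over `b` onto a `U`-Morley sequence
    -- extending the earlier `cᵢ`; the image of `b` is the new `bₙ`.
    obtain ⟨g, hg, hgd⟩ := hUV.symm d c (hd.mono hSb) hc
    obtain ⟨a', ha'⟩ := h𝕄.exists_av hY W (h𝕄.union_lt (mk_range_lt hZ (g ∘ b))
      (h𝕄.iUnion_range_lt hZ (fun i => (f i).1) fun i => i < n))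
    obtain ⟨c', hc'⟩ := h𝕄.exists_av hX U (h𝕄.union_lt (h𝕄.union_lt hS
      (h𝕄.union_lt (mk_range_lt hY a')
        (h𝕄.iUnion_range_lt hY (fun i => (f i).2.1) fun i => i < n)))
      (h𝕄.iUnion_range_lt hX (fun i => (f i).2.2) fun i => i < n))
    exact ⟨(g ∘ b, a', c'), ⟨g, d, hg, hd, rfl, fun i hi => by rw [hgd i, hcf i hi]⟩, ha', hc'⟩
  obtain ⟨f, hf⟩ := exists_seq (X := (Z → 𝕄) × (Y → 𝕄) × (X → 𝕄)) P hloc hstep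
  -- `Ψ` sees only `N` terms of a sequence. Sampling at multiples of `N` makes the first `N` terms
  -- of block `k` precede index `j * N` whenever `k < j`.
  obtain ⟨N, hN, hbound⟩ := exists_bound (𝕄 := 𝕄) Ψ
  have hlt : ∀ {i j : ℕ}, i < j → i * N < j * N := fun h => Nat.mul_lt_mul_of_pos_right h hN
  have hSb' : ∀ n, S ⊆ Set.range (f n).1 := fun n => by
    obtain ⟨g, d, hg, -, hgb, -⟩ := (hf n).1
    rw [hgb]
    exact hg.subset_range_comp hSb
  have ha' : ∀ n, ∃ g : 𝕄 ≃[L] 𝕄, Fixes L g S ∧ g ∘ a = (f n).2.1 := fun n =>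
    h𝕄.exists_fixes hY hS ((haW.mono hSb).sameTypeOver
      ((hf n).2.1.mono ((hSb' n).trans Set.subset_union_left)))
  obtain ⟨i, j, hij, z, hz⟩ : ∃ i j, i < j ∧ ∃ z,
      Φ.Realize (Sum.elim z (f (j * N)).2.1) ∧ Ψ.Realize (Sum.elim z (f (i * N)).1) := by
    refine NSOP.exists_realize hT Φ Ψ (fun (k : ℕ) (t : ℕ × X) => (f (k * N + t.1)).2.2 t.2)
      (fun i => (f (i * N)).2.1) (fun j => (f (j * N)).1) ?_ ?_
    · intro i k hik
      obtain ⟨g, hg, hga⟩ := ha' (i * N)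
      rw [← hga]
      refine hΦ g (fun t x => (f (k * N + t)).2.2 x) hg fun t => ?_
      refine (hf (k * N + t)).2.2.mono (Set.union_subset_union ?_ ?_)
      · rw [hga]
        exact fun m hm => Or.inr (Or.inr (Set.mem_iUnion₂.2
          ⟨i * N, (hlt hik).trans_le (Nat.le_add_right _ _), hm⟩))
      · exact Set.iUnion₂_subset fun j hj => Set.subset_iUnion₂_of_subset (k * N + j)
          (Nat.add_lt_add_left hj _) subset_rfl
    · intro k j hkj
      obtain ⟨g, d, hg, hd, hgb, hgd⟩ := (hf (j * N)).1
      rw [hgb]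
      have h1 : Morley L V (Set.range (g ∘ b)) fun t => g ∘ d (k * N + t) := by
        rw [Set.range_comp]
        exact (hd.comp_strictMono (f := fun t => k * N + t)
          fun s t hst => Nat.add_lt_add_left hst _).comp_equiv hV hg
      refine (hbound (fun t x => (f (k * N + t)).2.2 x) (fun t => g ∘ d (k * N + t)) _
        fun i hi => ?_).2 (hΨ g _ hg h1)
      refine hgd (k * N + i) ?_
      calc k * N + i < k * N + N := Nat.add_lt_add_left hi _
        _ = (k + 1) * N := (Nat.succ_mul _ _).symm
        _ ≤ j * N := Nat.mul_le_mul_right N hkj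
  -- Since `a_{jN}` realizes `W` over `b_{iN}`, the pair is conjugate to `(a, b)`, over which `Φ`
  -- and `Ψ` are contradictory.
  obtain ⟨g, d, hg, -, hgb, -⟩ := (hf (i * N)).1
  have h1 : Av L W (Set.range b) (g.symm ∘ (f (j * N)).2.1) := by
    refine (((hf (j * N)).2.1.mono (A := Set.range (f (i * N)).1) fun m hm =>
      Or.inr (Set.mem_iUnion₂.2 ⟨i * N, hlt hij, hm⟩)).comp_equiv hW hg.symm).mono ?_
    rw [hgb, ← Set.range_comp]
    rintro - ⟨k, rfl⟩
    exact ⟨k, by simp⟩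
  obtain ⟨r, hr, hra⟩ := h𝕄.exists_fixes hY (mk_range_lt hZ b) (haW.sameTypeOver h1)
  refine hcon (g.comp r) ⟨z, ?_⟩
  have h2 : (g.comp r) ∘ a = (f (j * N)).2.1 := funext fun k => by
    have := congrFun hra k
    simp only [Function.comp_apply] at this
    simp [this]
  have h3 : (g.comp r) ∘ b = (f (i * N)).1 := funext fun k => by
    rw [hgb]
    simp [hr (b k) ⟨k, rfl⟩]
  rw [h2, h3]
  exact hz

end

/-! ### Finite satisfiability and ultrafilters -/

section FiniteSatisfiability

theorem exists_ultrafilter_of_directed {I V : Type*} [Nonempty I] (F : Filter V) (s : I → Set V)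
    (hs : ∀ i, ∃ᶠ m in F, m ∈ s i) (hd : ∀ i j, ∃ k, s k ⊆ s i ∩ s j) :
    ∃ U : Ultrafilter V, ↑U ≤ F ∧ ∀ i, s i ∈ U := by
  have : (⨅ i, (F ⊓ Filter.principal (s i))).NeBot := by
    refine Filter.iInf_neBot_of_directed' (fun i j => ?_) fun i => ?_
    · obtain ⟨k, hk⟩ := hd i j
      exact ⟨k, inf_le_inf_left _ (Filter.principal_mono.2 (hk.trans Set.inter_subset_left)),
        inf_le_inf_left _ (Filter.principal_mono.2 (hk.trans Set.inter_subset_right))⟩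
    · exact Filter.frequently_mem_iff_neBot.1 (hs i)
  have hle : ∀ i, (↑(Ultrafilter.of (⨅ i, (F ⊓ Filter.principal (s i)))) : Filter V) ≤
      F ⊓ Filter.principal (s i) := fun i => (Ultrafilter.of_le _).trans (iInf_le _ i)
  exact ⟨_, (hle (Classical.arbitrary I)).trans inf_le_left, fun i =>
    (hle i).trans inf_le_right (Filter.mem_principal_self _)⟩

theorem exists_av_of_finitely_satisfiable {X : Type w} {A S : Set 𝕄} {c : X → 𝕄}
    (h : ∀ φ : L.Formula (X ⊕ A), φ.Realize (Sum.elim c (↑)) →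
      ∃ m : X → 𝕄, (∀ i, m i ∈ S) ∧ φ.Realize (Sum.elim m (↑))) :
    ∃ U : Ultrafilter (X → 𝕄), OnSet U S ∧ Av L U A c := by
  have : Nonempty {φ : L.Formula (X ⊕ A) // φ.Realize (Sum.elim c (↑))} :=
    ⟨⊤, Formula.realize_top.2 trivial⟩
  obtain ⟨U, -, hU⟩ := exists_ultrafilter_of_directed ⊤
    (fun φ : {φ : L.Formula (X ⊕ A) // φ.Realize (Sum.elim c (↑))} =>
      {m : X → 𝕄 | (∀ i, m i ∈ S) ∧ φ.1.Realize (Sum.elim m (↑))})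
    (fun φ => Filter.frequently_top.2 (h φ.1 φ.2))
    (fun φ ψ => ⟨⟨φ.1 ⊓ ψ.1, Formula.realize_inf.2 ⟨φ.2, ψ.2⟩⟩, fun m hm =>
      ⟨⟨hm.1, (Formula.realize_inf.1 hm.2).1⟩, ⟨hm.1, (Formula.realize_inf.1 hm.2).2⟩⟩⟩)
  refine ⟨U, Filter.mem_of_superset (hU (Classical.arbitrary _)) fun m hm => hm.1,
    fun φ hφ => by_contra fun hc => ?_⟩
  obtain ⟨m, hm, hm'⟩ := (hφ.and (hU ⟨φ.not, hc⟩)).exists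
  exact hm'.2 hm

/-- A Morley sequence in the average type of an ultrafilter on `S` is finitely satisfiable
in `S`. -/
theorem Morley.finitely_satisfiable {X : Type w} {A S : Set 𝕄} (hSA : S ⊆ A)
    {U : Ultrafilter (X → 𝕄)} (hU : OnSet U S) {c : ℕ → X → 𝕄} (hc : Morley L U A c)
    (φ : L.Formula ((ℕ × X) ⊕ A)) (hφ : φ.Realize (Sum.elim (fun k => c k.1 k.2) (↑))) :
    ∃ m : ℕ × X → 𝕄, (∀ k, m k ∈ S) ∧ φ.Realize (Sum.elim m (↑)) := by
  classical
  obtain ⟨N, -, hN⟩ := exists_bound (𝕄 := 𝕄) φ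
  obtain ⟨m₀, hm₀⟩ := hU.exists
  -- The terms are replaced by tuples from `S` from the last relevant one downwards, so that those
  -- already replaced are parameters in `S ⊆ A` when `c n` is treated.
  have key : ∀ t ≤ N, ∃ m : ℕ → X → 𝕄, φ.Realize (Sum.elim (fun k => m k.1 k.2) (↑)) ∧
      (∀ i < N - t, m i = c i) ∧ ∀ i, N - t ≤ i → ∀ x, m i x ∈ S := by
    intro t
    induction t with
    | zero =>
      refine fun _ => ⟨fun i => if i < N then c i else m₀, ?_, fun i hi => if_pos hi,
        fun i hi x => ?_⟩
      · exact (hN _ c _ fun i hi => if_pos hi).2 hφ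
      · change (if i < N then c i else m₀) x ∈ S
        rw [if_neg (show ¬ i < N from not_lt.2 hi)]
        exact hm₀ x
    | succ t ih =>
      intro ht
      obtain ⟨m, hm, hmc, hmS⟩ := ih (by omega)
      set n := N - (t + 1) with hn
      have hnt : N - t = n + 1 := by omega
      rw [hnt] at hmc hmS
      let r : (ℕ × X) ⊕ A → X ⊕ ({k : ℕ × X // k.1 ≠ n} ⊕ A) :=
        Sum.elim (fun k => if h : k.1 = n then Sum.inl k.2 else Sum.inr (Sum.inl ⟨k, h⟩))
          (Sum.inr ∘ Sum.inr)
      let b : {k : ℕ × X // k.1 ≠ n} ⊕ A → 𝕄 := Sum.elim (fun k => m k.1.1 k.1.2) (↑)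
      have hb : ∀ i, b i ∈ A ∪ ⋃ j < n, Set.range (c j) := by
        rintro (⟨⟨k, x⟩, hk⟩ | i)
        · rcases lt_or_gt_of_ne hk with hk | hk
          · refine Or.inr (Set.mem_iUnion₂.2 ⟨k, hk, x, ?_⟩)
            simp only [b, Sum.elim_inl]
            rw [hmc k (by omega)]
          · exact Or.inl (hSA (hmS k hk x))
        · exact Or.inl i.2
      have hr : ∀ y : X → 𝕄, (φ.relabel r).Realize (Sum.elim y b) ↔
          φ.Realize (Sum.elim (fun k => (if k.1 = n then y else m k.1) k.2) (↑)) := fun y => by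
        rw [Formula.realize_relabel]
        refine iff_of_eq (congrArg _ ?_)
        funext i
        rcases i with ⟨k, x⟩ | i
        · by_cases hk : k = n <;> simp [r, b, hk]
        · rfl
      have h1 : (φ.relabel r).Realize (Sum.elim (c n) b) := by
        rw [hr]
        refine (hN (fun i => if i = n then c n else m i) m _ fun i hi => ?_).2 hm
        split_ifs with h
        · rw [h, hmc n (by omega)]
        · rfl
      rw [(hc n).realize_iff b hb] at h1
      obtain ⟨y, hy, hyS⟩ := (h1.and hU).exists
      refine ⟨fun i => if i = n then y else m i, (hr y).1 hy, fun i hi => ?_, fun i hi x => ?_⟩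
      · exact (if_neg hi.ne).trans (hmc i (hi.trans n.lt_succ_self))
      · by_cases h : i = n
        · simpa [h] using hyS x
        · simp only [h, if_false]
          exact hmS i (lt_of_le_of_ne hi (Ne.symm h)) x
  obtain ⟨m, hm, -, hmS⟩ := key N le_rfl
  exact ⟨fun k => m k.1 k.2, fun k => hmS k.1 (by simp) k.2, hm⟩

variable (M : L.ElementarySubstructure 𝕄)

/-- The existential statement passes down to `M` by elementarity. -/
theorem exists_realize_mem [Nonempty 𝕄] {X Y : Type*} (φ : L.Formula (X ⊕ Y)) (y : Y → 𝕄)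
    (hy : ∀ i, y i ∈ M) (x : X → 𝕄) (h : φ.Realize (Sum.elim x y)) :
    ∃ m : X → 𝕄, (∀ i, m i ∈ M) ∧ φ.Realize (Sum.elim m y) := by
  obtain ⟨E, hE⟩ := exists_exists_formula.{u, v, w} φ
  let y' : Y → M := fun i => ⟨y i, hy i⟩
  have h1 : E.Realize (M.subtype ∘ y') := (hE 𝕄 y).2 ⟨x, h⟩
  rw [ElementaryEmbedding.map_formula, hE] at h1
  obtain ⟨m, hm⟩ := h1
  refine ⟨fun i => m i, fun i => (m i).2, ?_⟩
  rw [← ElementaryEmbedding.map_formula M.subtype, Sum.comp_elim] at hm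
  exact hm

theorem exists_av_elementarySubstructure [Nonempty 𝕄] {X : Type w} (c : X → 𝕄) :
    ∃ U : Ultrafilter (X → 𝕄), OnSet U (M : Set 𝕄) ∧ Av L U (M : Set 𝕄) c :=
  exists_av_of_finitely_satisfiable fun φ hφ => exists_realize_mem M φ _ (fun i => i.2) c hφ

/-- Left extension for finitely satisfiable types. -/
theorem Av.exists_left_extension [Nonempty 𝕄] {X E : Type w} {U : Ultrafilter (X → 𝕄)}
    (hU : OnSet U (M : Set 𝕄)) {c : X → 𝕄} (hc : Av L U (M : Set 𝕄) c) (e : E → 𝕄) :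
    ∃ U' : Ultrafilter (X ⊕ E → 𝕄), OnSet U' (M : Set 𝕄) ∧
      U'.map (fun m => m ∘ Sum.inl) = U ∧ Av L U' (M : Set 𝕄) (Sum.elim c e) := by
  let I := {φ : L.Formula ((X ⊕ E) ⊕ (M : Set 𝕄)) // φ.Realize (Sum.elim (Sum.elim c e) (↑))}
  have : Nonempty I := ⟨⊤, Formula.realize_top.2 trivial⟩
  have hfreq : ∀ φ : I, ∃ᶠ m in Filter.comap (fun m : X ⊕ E → 𝕄 => m ∘ Sum.inl) U,
      m ∈ {m : X ⊕ E → 𝕄 | (∀ i, m i ∈ (M : Set 𝕄)) ∧ φ.1.Realize (Sum.elim m (↑))} := by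
    intro φ
    let r : (X ⊕ E) ⊕ (M : Set 𝕄) → E ⊕ (X ⊕ (M : Set 𝕄)) :=
      Sum.elim (Sum.elim (Sum.inr ∘ Sum.inl) Sum.inl) (Sum.inr ∘ Sum.inr)
    have hr : ∀ (x : X → 𝕄) (z : E → 𝕄),
        (φ.1.relabel r).Realize (Sum.elim z (Sum.elim x (Subtype.val : ↥(M : Set 𝕄) → 𝕄))) ↔
          φ.1.Realize (Sum.elim (Sum.elim x z) (↑)) := fun x z => by
      rw [Formula.realize_relabel]
      refine iff_of_eq (congrArg _ ?_)
      funext i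
      rcases i with (i | i) | i <;> rfl
    obtain ⟨G, hG⟩ := exists_exists_formula.{u, v, w} (φ.1.relabel r)
    have hGc : G.Realize (Sum.elim c (Subtype.val : ↥(M : Set 𝕄) → 𝕄)) := (hG 𝕄 _).2 ⟨e, (hr c e).2 φ.2⟩
    rw [hc.realize_iff _ fun i => i.2] at hGc
    rw [Filter.frequently_comap]
    -- For `U`-almost every `m`, some `z` completes `m` to a solution of `φ`; as `m` lies in `M`,
    -- elementarity puts such a `z` in `M` too.
    refine Filter.Eventually.frequently ?_
    filter_upwards [hGc, hU] with m hm hmM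
    obtain ⟨z, hz⟩ := (hG 𝕄 _).1 hm
    obtain ⟨z', hz', hφz⟩ := exists_realize_mem M (φ.1.relabel r) (Sum.elim m Subtype.val)
      (by rintro (i | i); exacts [hmM i, i.2]) z hz
    refine ⟨Sum.elim m z', rfl, ?_, (hr m z').1 hφz⟩
    rintro (i | i)
    exacts [hmM i, hz' i]
  obtain ⟨U', hle, hU'⟩ := exists_ultrafilter_of_directed
    (Filter.comap (fun m : X ⊕ E → 𝕄 => m ∘ Sum.inl) U)
    (fun φ : I => {m : X ⊕ E → 𝕄 | (∀ i, m i ∈ (M : Set 𝕄)) ∧ φ.1.Realize (Sum.elim m (↑))})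
    hfreq
    (fun φ ψ => ⟨⟨φ.1 ⊓ ψ.1, Formula.realize_inf.2 ⟨φ.2, ψ.2⟩⟩, fun m hm =>
      ⟨⟨hm.1, (Formula.realize_inf.1 hm.2).1⟩, ⟨hm.1, (Formula.realize_inf.1 hm.2).2⟩⟩⟩)
  refine ⟨U', Filter.mem_of_superset (hU' (Classical.arbitrary _)) fun m hm => hm.1, ?_,
    fun φ hφ => by_contra fun hc => ?_⟩
  · refine Ultrafilter.coe_le_coe.1 ?_
    rw [Ultrafilter.coe_map]
    exact Filter.tendsto_iff_comap.2 hle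
  · obtain ⟨m, hm, hm'⟩ := (hφ.and (hU' ⟨φ.not, hc⟩)).exists
    exact hm'.2 hm

end FiniteSatisfiability

end ModelIndep

namespace ModelIndep

variable {L : FirstOrder.Language.{u, v}} {𝕄 : Type w}

/-! ### Global types as averages of ultrafilters -/

section GlobalTypes

theorem realize_inst_of_isExpansion {N : Type*} [L.Structure N] [L[[𝕄]].Structure N]
    [(L.lhomWithConstants 𝕄).IsExpansionOn N] {α β : Type*} (φ : L.Formula (α ⊕ β)) (b : β → 𝕄)
    (x : α → N) :
    (inst φ b).Realize x ↔ φ.Realize (Sum.elim x fun i => (L.con (b i) : N)) := by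
  unfold inst Formula.Realize
  rw [BoundedFormula.realize_subst, LHom.onFormula, LHom.realize_onBoundedFormula]
  refine iff_of_eq (congrArg (fun y => BoundedFormula.Realize φ y default) ?_)
  funext a
  cases a with
  | inl i => rfl
  | inr i => exact Term.realize_constants

theorem realize_relabel_append {N : Type*} [L.Structure N] {X : Type*} {n k : ℕ}
    (φ : L.Formula (X ⊕ Fin n)) (ψ : L.Formula (X ⊕ Fin k)) (x : X → N) (b : Fin n → N)
    (d : Fin k → N) :
    (φ.relabel (Sum.map id (Fin.castAdd k)) ⊓ ψ.relabel (Sum.map id (Fin.natAdd n))).Realize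
      (Sum.elim x (Fin.append b d)) ↔ φ.Realize (Sum.elim x b) ∧ ψ.Realize (Sum.elim x d) := by
  have h1 : Fin.append b d ∘ Fin.castAdd k = b := funext fun i => Fin.append_left b d i
  have h2 : Fin.append b d ∘ Fin.natAdd n = d := funext fun i => Fin.append_right b d i
  rw [Formula.realize_inf, Formula.realize_relabel, Formula.realize_relabel, Sum.elim_comp_map,
    Sum.elim_comp_map, h1, h2]
  rfl

variable [L.Structure 𝕄] {κ : Cardinal.{w}} {X : Type w}

theorem GlobalType.exists_ultrafilter [Nonempty 𝕄] (p : GlobalType L 𝕄 X) {M : L.ElementarySubstructure 𝕄}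
    (hp : p.IsFinSat M) :
    ∃ U : Ultrafilter (X → 𝕄), OnSet U (M : Set 𝕄) ∧
      ∀ (n : ℕ) (φ : L.Formula (X ⊕ Fin n)) (b : Fin n → 𝕄),
        p.Has φ b ↔ ∀ᶠ m in (U : Filter (X → 𝕄)), φ.Realize (Sum.elim m b) := by
  obtain ⟨N, v, hv⟩ := Theory.exists_modelType_is_realized_in _ p
  let _ : L.Structure N := (L.lhomWithConstants 𝕄).reduct N
  have : (L.lhomWithConstants 𝕄).IsExpansionOn N := LHom.isExpansionOn_reduct _ _
  have hHas : ∀ {n : ℕ} (φ : L.Formula (X ⊕ Fin n)) (b : Fin n → 𝕄), p.Has φ b ↔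
      φ.Realize (Sum.elim v fun i => (L.con (b i) : N)) := fun φ b => by
    rw [← realize_inst_of_isExpansion,
      ← Theory.CompleteType.formula_mem_typeOf (T := L.elementaryDiagram 𝕄), hv]
    rfl
  let I := {t : Σ n : ℕ, L.Formula (X ⊕ Fin n) × (Fin n → 𝕄) // p.Has t.2.1 t.2.2}
  have : Nonempty I := ⟨⟨0, ⊤, Fin.elim0⟩, (hHas _ _).2 (Formula.realize_top.2 trivial)⟩
  obtain ⟨U, -, hU⟩ := exists_ultrafilter_of_directed ⊤
    (fun t : I => {m : X → 𝕄 | (∀ i, m i ∈ M) ∧ t.1.2.1.Realize (Sum.elim m t.1.2.2)})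
    (fun t => Filter.frequently_top.2 (hp _ _ _ t.2)) (by
      rintro ⟨⟨n, φ, b⟩, h₁⟩ ⟨⟨k, ψ, d⟩, h₂⟩
      let θ : L.Formula (X ⊕ Fin (n + k)) := φ.relabel (Sum.map id (Fin.castAdd k)) ⊓
        ψ.relabel (Sum.map id (Fin.natAdd n))
      have hcon : (fun i => (L.con (Fin.append b d i) : N)) =
          Fin.append (fun i => (L.con (b i) : N)) fun i => (L.con (d i) : N) := by
        funext i
        refine Fin.addCases (fun i => ?_) (fun i => ?_) i <;> simp
      have hθ : p.Has θ (Fin.append b d) := by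
        rw [hHas, hcon, realize_relabel_append]
        exact ⟨(hHas _ _).1 h₁, (hHas _ _).1 h₂⟩
      refine ⟨⟨⟨n + k, θ, Fin.append b d⟩, hθ⟩, fun m hm => ?_⟩
      have := (realize_relabel_append φ ψ m b d).1 hm.2
      exact ⟨⟨hm.1, this.1⟩, ⟨hm.1, this.2⟩⟩)
  refine ⟨U, Filter.mem_of_superset (hU (Classical.arbitrary _)) fun m hm => hm.1,
    fun n φ b => ⟨fun h => Filter.mem_of_superset (hU ⟨⟨n, φ, b⟩, h⟩) fun m hm => hm.2,
      fun h => by_contra fun hc => ?_⟩⟩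
  have hn : p.Has φ.not b := (hHas _ _).2 fun h' => hc ((hHas _ _).2 h')
  obtain ⟨m, hm, hm'⟩ := (h.and (hU ⟨⟨n, φ.not, b⟩, hn⟩)).exists
  exact hm'.2 hm

/-- The type is that of the class of the identity in the ultrapower of `𝕄` by `U`. -/
theorem exists_globalType [Nonempty 𝕄] (U : Ultrafilter (X → 𝕄)) :
    ∃ p : GlobalType L 𝕄 X, ∀ (n : ℕ) (φ : L.Formula (X ⊕ Fin n)) (b : Fin n → 𝕄),
      p.Has φ b ↔ ∀ᶠ m in (U : Filter (X → 𝕄)), φ.Realize (Sum.elim m b) := by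
  let N := (U : Filter (X → 𝕄)).Product fun _ => 𝕄
  let _ : L[[𝕄]].Structure N := Ultraproduct.structure
  have : N ⊨ L.elementaryDiagram 𝕄 := ⟨fun σ hσ =>
    (Ultraproduct.sentence_realize σ).2 (Filter.Eventually.of_forall fun _ => hσ)⟩
  let v : X → N := fun i => ((fun m => m i : (X → 𝕄) → 𝕄) : N)
  refine ⟨(L.elementaryDiagram 𝕄).typeOf v, fun n φ b => ?_⟩
  unfold GlobalType.Has
  rw [Theory.CompleteType.formula_mem_typeOf]
  refine (Ultraproduct.realize_formula_cast (inst φ b)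
    fun i (m : X → 𝕄) => m i).trans ?_
  simp only [realize_inst]

theorem GlobalType.realizedOver_iff {p : GlobalType L 𝕄 X} {U : Ultrafilter (X → 𝕄)}
    (hpU : ∀ (n : ℕ) (φ : L.Formula (X ⊕ Fin n)) (b : Fin n → 𝕄),
      p.Has φ b ↔ ∀ᶠ m in (U : Filter (X → 𝕄)), φ.Realize (Sum.elim m b)) (A : Set 𝕄)
    (c : X → 𝕄) : p.RealizedOver A c ↔ Av L U A c := by
  constructor
  · intro h φ hφ
    obtain ⟨n, e, ψ, hψ⟩ := exists_finite_support_right.{u, v, w} φ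
    simp only [hψ] at hφ ⊢
    exact h n ψ _ (fun i => (e i).2) ((hpU _ _ _).2 hφ)
  · intro h n φ b hb hφ
    exact (h.realize_iff b hb φ).2 ((hpU _ _ _).1 hφ)

theorem EqTypeOver.sameTypeOver {A : Set 𝕄} {Y : Type*} {b b' : Y → 𝕄}
    (h : EqTypeOver L A b b') : SameTypeOver L A b b' := fun φ => by
  obtain ⟨ψ, hψ⟩ := exists_constants_formula ((↑) : A → 𝕄) (fun i => i.2) φ
  rw [← hψ, ← hψ]
  exact h ψ

theorem GlobalType.isInvariant_of_onSet {p : GlobalType L 𝕄 X} {U : Ultrafilter (X → 𝕄)}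
    {M : L.ElementarySubstructure 𝕄} (hU : OnSet U (M : Set 𝕄))
    (hpU : ∀ (n : ℕ) (φ : L.Formula (X ⊕ Fin n)) (b : Fin n → 𝕄),
      p.Has φ b ↔ ∀ᶠ m in (U : Filter (X → 𝕄)), φ.Realize (Sum.elim m b)) :
    p.IsInvariant M := by
  intro n φ b b' h hb
  rw [hpU] at hb ⊢
  filter_upwards [hb, hU] with m hm hmM
  let r : X ⊕ Fin n → Fin n ⊕ (M : Set 𝕄) := Sum.elim (fun i => Sum.inr ⟨m i, hmM i⟩) Sum.inl
  have hr : ∀ d : Fin n → 𝕄, (φ.relabel r).Realize (Sum.elim d (↑)) ↔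
      φ.Realize (Sum.elim m d) := fun d => by
    rw [Formula.realize_relabel]
    refine iff_of_eq (congrArg _ ?_)
    funext i
    rcases i with i | i <;> rfl
  rw [← hr] at hm ⊢
  exact (h.sameTypeOver _).1 hm

theorem Morley.isInvMorley [Nonempty 𝕄] {M : L.ElementarySubstructure 𝕄} {n : ℕ} {s : ℕ → Fin n → 𝕄}
    {U : Ultrafilter (ULift.{w} (Fin n) → 𝕄)} (hU : OnSet U (M : Set 𝕄))
    (hs : Morley L U (M : Set 𝕄) fun i k => s i k.down) : IsInvMorley M s := by
  obtain ⟨p, hp⟩ := exists_globalType (L := L) U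
  exact ⟨p, GlobalType.isInvariant_of_onSet hU hp, fun i =>
    (GlobalType.realizedOver_iff hp _ _).2 (hs i)⟩

theorem IsMonster.samePower (h𝕄 : IsMonster L 𝕄 κ) (hX : #X < κ) {M : L.ElementarySubstructure 𝕄}
    (hM : #M < κ) {p q : GlobalType L 𝕄 X} (hpq : p.morleyPower M = q.morleyPower M)
    {U V : Ultrafilter (X → 𝕄)} (hU : OnSet U (M : Set 𝕄))
    (hpU : ∀ (n : ℕ) (φ : L.Formula (X ⊕ Fin n)) (b : Fin n → 𝕄),
      p.Has φ b ↔ ∀ᶠ m in (U : Filter (X → 𝕄)), φ.Realize (Sum.elim m b))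
    (hqV : ∀ (n : ℕ) (φ : L.Formula (X ⊕ Fin n)) (b : Fin n → 𝕄),
      q.Has φ b ↔ ∀ᶠ m in (V : Filter (X → 𝕄)), φ.Realize (Sum.elim m b)) :
    SamePower L U V (M : Set 𝕄) := by
  intro c c' hc hc'
  have h : SameTypeOver L (M : Set 𝕄) (fun k : ℕ × X => c k.1 k.2) fun k => c' k.1 k.2 := by
    refine sameType_of_imp fun φ hφ => ?_
    obtain ⟨ψ, hψ⟩ := exists_constants_formula (Subtype.val : ↥(M : Set 𝕄) → 𝕄) (fun i => i.2) φ
    have h1 : ψ ∈ p.morleyPower M := by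
      intro d hd
      obtain ⟨g, hg, hgc⟩ := h𝕄.exists_fixes_morley hX hM hU subset_rfl hc
        fun i => (GlobalType.realizedOver_iff hpU _ _).1 (hd i)
      rw [hψ]
      have h2 := hg.sameTypeOver (fun k : ℕ × X => c k.1 k.2)
      have h3 : (g ∘ fun k : ℕ × X => c k.1 k.2) = fun k => d k.1 k.2 :=
        funext fun k => congrFun (hgc k.1) k.2
      rw [h3] at h2
      exact (h2 φ).2 hφ
    rw [hpq] at h1
    exact (hψ _).1 (h1 c' fun i => (GlobalType.realizedOver_iff hqV _ _).2 (hc' i))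
  obtain ⟨g, hg, hgc⟩ := h𝕄.exists_fixes (h𝕄.nat_prod_lt hX) hM h
  exact ⟨g, hg, fun i => funext fun x => congrFun hgc (i, x)⟩

end GlobalTypes

end ModelIndep

namespace ModelIndep

variable {L : FirstOrder.Language.{u, v}} {𝕄 : Type w} [L.Structure 𝕄] {κ : Cardinal.{w}}

/-! ### Common Morley sequences: the Kim-independent case -/

section KimIndependence

variable [Nonempty 𝕄] {M : L.ElementarySubstructure 𝕄} {A B : Set 𝕄}

theorem KimIndep.exists_realize (hAB : KimIndep M A B) {s : ℕ → B → 𝕄}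
    (hs0 : s 0 = (↑)) {W : Ultrafilter (B → 𝕄)} (hW : OnSet W (M : Set 𝕄))
    (hs : Morley L W (M : Set 𝕄) s) (φ : L.Formula (A ⊕ B))
    (hφ : φ.Realize (Sum.elim ((↑) : A → 𝕄) ((↑) : B → 𝕄))) :
    ∃ y : A → 𝕄, ∀ i, φ.Realize (Sum.elim y (s i)) := by
  obtain ⟨n, e, ψ, hψ⟩ := exists_finite_support_right.{u, v, w} φ
  simp only [hψ] at hφ ⊢
  by_contra hcon
  refine hAB n ψ _ (fun i => Or.inr (e i).2) hφ ⟨1, fun _ => n, fun _ => ψ, fun _ i => e i,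
    fun _ => ⟨fun i => s i ∘ e, ?_, ?_, hcon⟩, fun x hx => ⟨0, hx⟩⟩
  · exact Morley.isInvMorley (hW.comp_map (e ∘ ULift.down)) (hs.comp_map (e ∘ ULift.down))
  · beta_reduce
    rw [hs0]
    rfl

/-- No formula of `tp(A/B)` Kim-divides along a Morley sequence starting at `B`, so compactness
gives a common realization; uniqueness of Morley sequences carries it to `s`. -/
theorem KimIndep.exists_sameType (h𝕄 : IsMonster L 𝕄 κ) (hM : #M < κ) (hA : #A < κ) (hB : #B < κ)
    (hAB : KimIndep M A B) {W : Ultrafilter (B → 𝕄)} (hW : OnSet W (M : Set 𝕄))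
    (hBW : Av L W (M : Set 𝕄) (↑)) {s : ℕ → B → 𝕄} (hs : Morley L W (M : Set 𝕄) s) :
    ∃ y : A → 𝕄, ∀ i, SameType L (Sum.elim (↑) (↑)) (Sum.elim y (s i)) := by
  classical
  obtain ⟨s', hs', hs0⟩ := h𝕄.exists_morley_extending hB W hM 1 (fun _ => (↑)) (by
    intro i hi
    obtain rfl : i = 0 := by omega
    simpa using hBW)
  let t : ℕ × L.Formula (A ⊕ B) → L.Formula (A ⊕ (ℕ × B)) := fun φ =>
    φ.2.relabel (Sum.map id (Prod.mk φ.1))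
  have ht : ∀ φ y, (t φ).Realize (Sum.elim y fun k => s' k.1 k.2) ↔
      φ.2.Realize (Sum.elim y (s' φ.1)) := fun φ y => by
    simp only [t, Formula.realize_relabel, Sum.elim_comp_map]
    rfl
  obtain ⟨y, hy⟩ := h𝕄.exists_realize hA (h𝕄.nat_prod_lt hB) (fun k : ℕ × B => s' k.1 k.2)
    (t '' {φ | φ.2.Realize (Sum.elim ((↑) : A → 𝕄) ((↑) : B → 𝕄))}) (by
      intro r hr
      obtain ⟨r', hr', rfl⟩ := Finset.subset_set_image_iff.1 hr
      obtain ⟨y, hy⟩ := hAB.exists_realize (hs0 0 one_pos) hW hs'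
        ((r'.toList.map Prod.snd).foldr (· ⊓ ·) ⊤) ((realize_foldr_inf _ _).2 fun φ hφ => by
          obtain ⟨ψ, hψ, rfl⟩ := List.mem_map.1 hφ
          exact hr' (Finset.mem_toList.1 hψ))
      refine ⟨y, fun φ hφ => ?_⟩
      obtain ⟨ψ, hψ, rfl⟩ := Finset.mem_image.1 hφ
      exact (ht ψ y).2 ((realize_foldr_inf _ _).1 (hy ψ.1) ψ.2
        (List.mem_map.2 ⟨ψ, Finset.mem_toList.2 hψ, rfl⟩)))
  obtain ⟨g, hg, hgs⟩ := h𝕄.exists_fixes_morley hB hM hW subset_rfl hs' hs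
  refine ⟨g ∘ y, fun i => sameType_of_imp fun φ hφ => ?_⟩
  rw [← hgs i, realize_elim_comp_equiv]
  exact (ht (i, φ) y).1 (hy _ ⟨(i, φ), hφ, rfl⟩)

variable {T : L.Theory} [𝕄 ⊨ T]

/-- In an `NSOP₃` theory, if `A` is Kim-independent from `B` over `M`, a single sequence is Morley
over `A` in `U` and over `B` in `V`. -/
theorem KimIndep.exists_joint_morley (h𝕄 : IsMonster L 𝕄 κ) (hT : NSOP.{u, v, w} T 3)
    (hM : #M < κ) (hA : #A < κ) (hB : #B < κ) (hMA : (M : Set 𝕄) ⊆ A) (hMB : (M : Set 𝕄) ⊆ B)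
    (hAB : KimIndep M A B) {X : Type w} (hX : #X < κ) {U V : Ultrafilter (X → 𝕄)}
    (hU : OnSet U (M : Set 𝕄)) (hV : OnSet V (M : Set 𝕄)) (hUV : SamePower L U V (M : Set 𝕄)) :
    ∃ c, Morley L U A c ∧ Morley L V B c := by
  rcases h𝕄.exists_morley_or hX hA hB hU hV ((↑) : A → 𝕄) ((↑) : B → 𝕄) (by simpa using hMA)
    (by simpa using hMB) with h | ⟨Φ, Ψ, hΦ, hΨ, hcon⟩
  · simpa using h
  exfalso
  obtain ⟨W, hW, hBW⟩ := exists_av_elementarySubstructure M ((↑) : B → 𝕄)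
  -- The pair is `(bₙ, aₙ)`: `bₙ` realizes `W` over `M` and all earlier `aᵢ, bᵢ`, and `aₙ` is
  -- related to each of `b₀, …, bₙ` as `A` is to `B`.
  let P : ℕ → (ℕ → (B → 𝕄) × (A → 𝕄)) → (B → 𝕄) × (A → 𝕄) → Prop := fun n f t =>
    Av L W (((M : Set 𝕄) ∪ ⋃ i < n, Set.range (f i).2) ∪ ⋃ i < n, Set.range (f i).1) t.1 ∧
      (∀ i < n, SameType L (Sum.elim (↑) (↑)) (Sum.elim t.2 (f i).1)) ∧
      SameType L (Sum.elim (↑) (↑)) (Sum.elim t.2 t.1)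
  have hloc : ∀ n f f' t, (∀ i < n, f i = f' i) → P n f t → P n f' t := by
    intro n f f' t hff ⟨h1, h2, h3⟩
    refine ⟨h1.mono ?_, fun i hi => hff i hi ▸ h2 i hi, h3⟩
    refine Set.union_subset_union (Set.union_subset_union_right _
      (Set.iUnion₂_mono fun i hi => ?_)) (Set.iUnion₂_mono fun i hi => ?_) <;> rw [hff i hi]
  have hstep : ∀ n f, (∀ i < n, P i f (f i)) → ∃ t, P n f t := by
    intro n f hf
    obtain ⟨b', hb'⟩ := h𝕄.exists_av hB W (h𝕄.union_lt (h𝕄.union_lt hM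
      (h𝕄.iUnion_range_lt hA (fun i => (f i).2) fun i => i < n))
      (h𝕄.iUnion_range_lt hB (fun i => (f i).1) fun i => i < n))
    let d : ℕ → B → 𝕄 := fun i => if i < n then (f i).1 else b'
    have hd : ∀ i < n, d i = (f i).1 := fun i hi => if_pos hi
    have hdn : d n = b' := if_neg (lt_irrefl n)
    obtain ⟨s, hs, hsd⟩ := h𝕄.exists_morley_extending hB W hM (n + 1) d (by
      intro i hi
      have hsub : (⋃ j < i, Set.range (d j)) ⊆ ⋃ j < i, Set.range (f j).1 :=
        Set.iUnion₂_mono fun j hj => by rw [hd j (by omega)]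
      rcases Nat.lt_succ_iff_lt_or_eq.1 hi with hi | rfl
      · rw [hd i hi]
        exact (hf i hi).1.mono (Set.union_subset_union Set.subset_union_left hsub)
      · rw [hdn]
        exact hb'.mono (Set.union_subset_union Set.subset_union_left hsub))
    obtain ⟨y, hy⟩ := hAB.exists_sameType h𝕄 hM hA hB hW hBW hs
    refine ⟨(b', y), hb', fun i hi => ?_, ?_⟩
    · have := hy i
      rwa [hsd i (hi.trans n.lt_succ_self), hd i hi] at this
    · have := hy n
      rwa [hsd n n.lt_succ_self, hdn] at this
  obtain ⟨f, hf⟩ := exists_seq P hloc hstep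
  have hconj : ∀ i j, i ≤ j → ∃ g : 𝕄 ≃[L] 𝕄, Fixes L g (M : Set 𝕄) ∧
      g ∘ ((↑) : A → 𝕄) = (f j).2 ∧ g ∘ ((↑) : B → 𝕄) = (f i).1 := by
    intro i j hij
    have hsame : SameType L (Sum.elim ((↑) : A → 𝕄) ((↑) : B → 𝕄))
        (Sum.elim (f j).2 (f i).1) := by
      rcases hij.lt_or_eq with h | rfl
      · exact (hf j).2.1 i h
      · exact (hf i).2.2
    obtain ⟨g, hg⟩ := h𝕄.exists_equiv (h𝕄.sum_lt hA hB) hsame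
    have hgB : g ∘ ((↑) : B → 𝕄) = (f i).1 := funext fun x => congrFun hg (Sum.inr x)
    refine ⟨g, fun m hm => ?_, funext fun x => congrFun hg (Sum.inl x), hgB⟩
    -- `g` agrees on `B ⊇ M` with an automorphism fixing `M`.
    obtain ⟨r, hr, hrB⟩ := h𝕄.exists_fixes hB hM (hBW.sameTypeOver
      ((hf i).1.mono (Set.subset_union_left.trans Set.subset_union_left)))
    have h1 := congrFun (hgB.trans hrB.symm) ⟨m, hMB hm⟩
    exact h1.trans (hr m hm)
  have hC : ∀ k, ∃ c : ℕ → X → 𝕄, (∀ i ≤ k, Morley L U (Set.range (f i).2) c) ∧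
      ∀ j, k < j → Morley L V (Set.range (f j).1) c := by
    intro k
    -- `a'` enumerates `a₀, …, aₖ`, the last repeated forever, and `b'` enumerates the `bⱼ` with `j
    -- > k`.
    let a' : ℕ × A → 𝕄 := fun t => (f (min t.1 k)).2 t.2
    let b' : ℕ × B → 𝕄 := fun t => (f (k + 1 + t.1)).1 t.2
    have hMa' : (M : Set 𝕄) ⊆ Set.range a' := fun m hm => by
      obtain ⟨g, hg, hga, -⟩ := hconj 0 0 le_rfl
      refine ⟨(0, ⟨m, hMA hm⟩), ?_⟩
      change (f (min 0 k)).2 _ = _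
      rw [Nat.zero_min, ← hga]
      exact hg m hm
    have hMb' : (M : Set 𝕄) ⊆ Set.range b' := fun m hm => by
      obtain ⟨g, hg, -, hgb⟩ := hconj (k + 1) (k + 1) le_rfl
      refine ⟨(0, ⟨m, hMB hm⟩), ?_⟩
      change (f (k + 1)).1 _ = _
      rw [← hgb]
      exact hg m hm
    have hmor : Morley L W (Set.range a') fun j => (f (k + 1 + j)).1 := by
      intro j
      refine (hf (k + 1 + j)).1.mono (Set.union_subset_union ?_ ?_)
      · rintro - ⟨⟨i, x⟩, rfl⟩
        exact Or.inr (Set.mem_iUnion₂.2 ⟨min i k, by omega, x, rfl⟩)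
      · exact Set.iUnion₂_subset fun i hi => Set.subset_iUnion₂_of_subset (k + 1 + i)
          (Nat.add_lt_add_left hi _) subset_rfl
    obtain ⟨W', hW', hbW'⟩ := exists_av_of_finitely_satisfiable
      (hmor.finitely_satisfiable hMa' hW)
    -- Here `b'` is finitely satisfiable over `a'`, so `U` and `V` exchange roles.
    obtain ⟨c, hcV, hcU⟩ := h𝕄.exists_joint_morley_of_av hT hX (h𝕄.nat_prod_lt hB)
      (h𝕄.nat_prod_lt hA) hV hU hUV.symm b' a' hMb' hMa' hW' hbW'
    refine ⟨c, fun i hi => hcU.mono ?_, fun j hj => hcV.mono ?_⟩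
    · rintro - ⟨x, rfl⟩
      exact ⟨(i, x), by simp [a', hi]⟩
    · rintro - ⟨x, rfl⟩
      refine ⟨(j - (k + 1), x), ?_⟩
      simp only [b']
      rw [Nat.add_sub_cancel' hj]
  choose c hcU hcV using hC
  obtain ⟨i, j, hij, z, hz⟩ := NSOP.exists_realize hT Φ Ψ
    (fun (k : ℕ) (t : ℕ × X) => c k t.1 t.2) (fun i => (f i).2) (fun j => (f j).1)
    (fun i k hik => by
      obtain ⟨g, hg, hga, -⟩ := hconj i i le_rfl
      rw [← hga]
      refine hΦ g (c k) hg ?_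
      rw [hga]
      exact hcU k i hik.le)
    (fun k j hkj => by
      obtain ⟨g, hg, -, hgb⟩ := hconj j j le_rfl
      rw [← hgb]
      refine hΨ g (c k) hg ?_
      rw [hgb]
      exact hcV k j hkj)
  obtain ⟨g, -, hga, hgb⟩ := hconj i j hij.le
  refine hcon g ⟨z, ?_⟩
  rw [hga, hgb]
  exact hz

end KimIndependence

/-! ### Conant-independence from limits of Morley sequences -/

section ConantIndependence

theorem Morley.comp_fixes {X : Type w} {S : Set 𝕄} {U : Ultrafilter (X → 𝕄)} {s : ℕ → X → 𝕄}
    (hs : Morley L U S s) (hU : OnSet U S) {g : 𝕄 ≃[L] 𝕄} (hg : Fixes L g S) :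
    Morley L U S fun i => g ∘ s i :=
  (hs.comp_equiv hU hg).mono fun m hm => ⟨m, hm, hg m hm⟩

theorem Morley.av_of_av_map {X : Type w} {A D : Set 𝕄} {U : Ultrafilter (X → 𝕄)}
    {C : ℕ → X → 𝕄} (hC : Morley L U A C) (hAD : A ⊆ D) {c : X → 𝕄} {F : Ultrafilter ℕ}
    (hc : Av L (F.map C) D c) : Av L U A c := fun φ hφ =>
  (hc.realize_iff _ (fun i => hAD i.2) φ).2
    (Filter.mem_map.2 (Filter.Eventually.of_forall fun i => hC.av i φ hφ))

/-- If `c` realizes over `D` a limit type of a Morley sequence in a finitely satisfiable type, then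
`D` is Conant-independent from `c`. -/
theorem Morley.conantIndep [Nonempty 𝕄] (h𝕄 : IsMonster L 𝕄 κ) {M : L.ElementarySubstructure 𝕄}
    (hM : #M < κ) {X : Type w} (hX : #X < κ) {U : Ultrafilter (X → 𝕄)}
    (hU : OnSet U (M : Set 𝕄)) {C : ℕ → X → 𝕄} (hC : Morley L U (M : Set 𝕄) C) {D : Set 𝕄}
    (hMD : (M : Set 𝕄) ⊆ D) {c : X → 𝕄}
    (hc : Av L ((Filter.hyperfilter ℕ).map C) D c) : ConantIndep M D (Set.range c) := by
  rintro n φ d hd hφ ⟨m, k, ψ, e, hdiv, himp⟩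
  have hcU : Av L U (M : Set 𝕄) c := hC.av_of_av_map hMD hc
  have hδ : ∀ i, ∃ t : X ⊕ (M : Set 𝕄), Sum.elim c (↑) t = d i := by
    intro i
    rcases hd i with h | ⟨x, hx⟩
    · exact ⟨Sum.inr ⟨d i, h⟩, rfl⟩
    · exact ⟨Sum.inl x, hx⟩
  choose δ hδ using hδ
  let r : D ⊕ Fin n → X ⊕ (D ⊕ (M : Set 𝕄)) := Sum.elim (Sum.inr ∘ Sum.inl)
    (Sum.elim Sum.inl (Sum.inr ∘ Sum.inr) ∘ δ)
  have hr : ∀ x : X → 𝕄, (φ.relabel r).Realize (Sum.elim x (Sum.elim Subtype.val Subtype.val)) ↔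
      φ.Realize (Sum.elim (↑) (Sum.elim x (↑) ∘ δ)) := fun x => by
    rw [Formula.realize_relabel]
    refine iff_of_eq (congrArg _ ?_)
    funext i
    rcases i with i | i
    · rfl
    · simp only [r, Function.comp_apply, Sum.elim_inr]
      rcases δ i with t | t <;> rfl
  have hfreq : ∃ᶠ i in Filter.atTop, φ.Realize (Sum.elim (↑) (Sum.elim (C i) (↑) ∘ δ)) := by
    have h1 : (φ.relabel r).Realize (Sum.elim c (Sum.elim Subtype.val Subtype.val)) :=
      (hr c).2 (by rwa [show Sum.elim c (↑) ∘ δ = d from funext hδ])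
    rw [hc.realize_iff _ (by rintro (i | i); exacts [i.2, hMD i.2])] at h1
    have h2 : ∀ᶠ i in (Filter.hyperfilter ℕ : Filter ℕ),
        φ.Realize (Sum.elim (↑) (Sum.elim (C i) (↑) ∘ δ)) :=
      Filter.Eventually.mono (Filter.mem_map.1 h1) fun i hi => (hr (C i)).1 hi
    refine h2.frequently.filter_mono ?_
    rw [← Nat.cofinite_eq_atTop]
    exact Filter.hyperfilter_le_cofinite
  obtain ⟨f, hf, hfφ⟩ := Filter.extraction_of_frequently_atTop hfreq
  let E := ULift.{w} (Σ j : Fin m, Fin (k j))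
  have hE : #E < κ := (lt_aleph0_of_finite E).trans h𝕄.aleph0_lt
  -- The parameters `e` of the disjunction are absorbed into a type extending that of `c`, whose
  -- Morley sequences can be arranged to project onto the subsequence `C ∘ f`. Thus `D` satisfies
  -- each conjugate of `φ(x, d)`, hence some disjunct of each conjugate disjunction.
  obtain ⟨U', hU', hmap, hceU'⟩ := hcU.exists_left_extension M hU
    (fun t : E => e t.down.1 t.down.2)
  obtain ⟨s₀, hs₀⟩ := h𝕄.exists_morley (h𝕄.sum_lt hX hE) U' hM
  have hs₀' : Morley L U (M : Set 𝕄) fun i => s₀ i ∘ Sum.inl := hmap ▸ hs₀.comp_map Sum.inl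
  obtain ⟨g, hg, hgs⟩ := h𝕄.exists_fixes_morley hX hM hU subset_rfl hs₀'
    (hC.comp_strictMono hf)
  have hs : Morley L U' (M : Set 𝕄) fun i => g ∘ s₀ i := hs₀.comp_fixes hU' hg
  have hh : ∀ i, ∃ h : 𝕄 ≃[L] 𝕄, Fixes L h (M : Set 𝕄) ∧
      h ∘ Sum.elim c (fun t : E => e t.down.1 t.down.2) = g ∘ s₀ i := fun i =>
    h𝕄.exists_fixes (h𝕄.sum_lt hX hE) hM (hceU'.sameTypeOver (hs.av i))
  choose h hhM hhs using hh
  have hψ : ∀ i, ∃ j, (ψ j).Realize (Sum.elim (Subtype.val : D → 𝕄) (h i ∘ e j)) := by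
    intro i
    have hhd : h i ∘ d = Sum.elim (C (f i)) (↑) ∘ δ := by
      funext t
      rw [Function.comp_apply, ← hδ t, Function.comp_apply, ← hgs i]
      rcases δ t with x | x
      · exact congrFun (hhs i) (Sum.inl x)
      · exact hhM i x x.2
    have hx : h i ∘ ((h i).symm ∘ (Subtype.val : D → 𝕄)) = Subtype.val :=
      funext fun t => (h i).apply_symm_apply _
    obtain ⟨j, hj⟩ := himp ((h i).symm ∘ Subtype.val) (by
      rw [← realize_elim_comp_equiv (h i), hx, hhd]
      exact hfφ i)
    refine ⟨j, ?_⟩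
    rw [← hx, realize_elim_comp_equiv]
    exact hj
  -- By pigeonhole one disjunct recurs infinitely often; `D` then realizes it along a whole Morley
  -- subsequence.
  obtain ⟨j, hj⟩ : ∃ j, ∃ᶠ i in Filter.atTop,
      (ψ j).Realize (Sum.elim (Subtype.val : D → 𝕄) (h i ∘ e j)) := by
    by_contra! hcon
    obtain ⟨i, hi⟩ := (Filter.eventually_all.2 fun j => hcon j).exists
    obtain ⟨j, hj⟩ := hψ i
    exact hi j hj
  obtain ⟨f', hf', hfψ⟩ := Filter.extraction_of_frequently_atTop hj
  let ε : ULift.{w} (Fin (k j)) → X ⊕ E := fun t => Sum.inr ⟨⟨j, t.down⟩⟩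
  -- Pulling back by `h (f' 0)` makes the sequence start at `e j` itself, as Conant-dividing
  -- requires.
  have hmor : Morley L (U'.map fun m => m ∘ ε) (M : Set 𝕄)
      fun i t => (h (f' 0)).symm (h (f' i) (e j t.down)) := by
    convert ((hs.comp_strictMono hf').comp_fixes hU' (hhM (f' 0)).symm).comp_map ε using 2 with i
    funext t
    exact congrArg _ (congrFun (hhs (f' i)) (ε t))
  refine hdiv j (fun i t => (h (f' 0)).symm (h (f' i) (e j t)))
    (Morley.isInvMorley (hU'.comp_map ε) hmor) (funext fun t => (h (f' 0)).symm_apply_apply _)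
    ⟨(h (f' 0)).symm ∘ Subtype.val, fun i => ?_⟩
  exact (realize_elim_comp_equiv (h (f' 0)).symm (ψ j) Subtype.val (h (f' i) ∘ e j)).2 (hfψ i)

end ConantIndependence

end ModelIndep

theorem mainTheorem3 {L : FirstOrder.Language.{u, v}} (T : L.Theory) (hT : T.IsComplete)
    (𝕄 : Type w) [L.Structure 𝕄] [Nonempty 𝕄] [𝕄 ⊨ T] (κ : Cardinal.{w})
    (h𝕄 : ModelIndep.IsMonster L 𝕄 κ)
    (hNSOP : ModelIndep.NSOP.{u, v, w} T 3)
    (hsymm : ModelIndep.ConantSymmetric L 𝕄 κ)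
    (M : L.ElementarySubstructure 𝕄) (hM : #M < κ)
    (α : Type w) (hα : #α < κ) (p q : ModelIndep.GlobalType L 𝕄 α)
    (hp : p.IsFinSat M) (hq : q.IsFinSat M)
    (hpq : p.morleyPower M = q.morleyPower M)
    (a b : Set 𝕄) (hMa : (M : Set 𝕄) ⊆ a) (hMb : (M : Set 𝕄) ⊆ b) (ha : #a < κ) (hb : #b < κ)
    (hab : ModelIndep.KimIndep M a b) :
    ∃ c : α → 𝕄, p.RealizedOver a c ∧ q.RealizedOver b c ∧
      ModelIndep.ConantIndep M (Set.range c) (a ∪ b) := by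
  obtain ⟨U, hU, hpU⟩ := p.exists_ultrafilter hp
  obtain ⟨V, hV, hqV⟩ := q.exists_ultrafilter hq
  obtain ⟨C, hCU, hCV⟩ := hab.exists_joint_morley h𝕄 hNSOP hM ha hb hMa hMb hα hU hV
    (h𝕄.samePower hα hM hpq hU hpU hqV)
  have hD : #(a ∪ b : Set 𝕄) < κ := h𝕄.union_lt ha hb
  -- A nonprincipal limit ensures that each formula true of `c` over `a ∪ b` holds of infinitely
  -- many terms of `C`.
  obtain ⟨c, hc⟩ := h𝕄.exists_av hα ((Filter.hyperfilter ℕ).map C) hD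
  refine ⟨c, ?_, ?_, hsymm M _ _ hM hD (ModelIndep.mk_range_lt hα c)
    ((hCU.mono hMa).conantIndep h𝕄 hM hα hU (hMa.trans Set.subset_union_left) hc)⟩
  · rw [ModelIndep.GlobalType.realizedOver_iff hpU]
    exact hCU.av_of_av_map Set.subset_union_left hc
  · rw [ModelIndep.GlobalType.realizedOver_iff hqV]
    exact hCV.av_of_av_map Set.subset_union_right hc
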